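/- Let $K$ be an algebraically closed field of characteristic zero, $G$ a group with centre $Z(G)$, $\chi,\eta\colon G\to K^\times$ two characters, $b,c\in Z(G)$ with $\eta(b)=\chi(c)^{-1}$, and $\beta\in K$. For an automorphism $\sigma$ and a $\sigma$-derivation $\delta$ of an algebra $R$ (that is, a linear map with $\delta(rs)=\sigma(r)\delta(s)+\delta(r)s$), the Ore extension $R[x;\sigma,\delta]$ is the free left $R$-module with basis $\{x^i\}_{i\ge 0}$ and multiplication determined by $xr=\sigma(r)x+\delta(r)$. Let $A=K[G][x;\tau_\chi,0]$ with $\tau_\chi(g)=\chi(g)g$, and let $\tau_\eta$ be the automorphism of $A$ with $\tau_\eta(g)=\eta(g)g$ and $\tau_\eta(x)=\eta(b)x$. There is a $\tau_\eta$-derivation $\delta$ of $A$ with $\delta|_{K[G]}=0$ and $\delta(x)=\beta(1-cb)$ if and only if $\beta(1-bc)=0$ or $\eta=\chi^{-1}$; it is then unique. Whenever it exists, $H=H(G,\chi,\eta,b,c,\beta)$ denotes $A[y;\tau_\eta,\delta]$. Thus $xg=\chi(g)gx$, $yg=\eta(g)gy$, $yx=\eta(b)xy+\beta(1-cb)$,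 and $H$ is a Hopf algebra with $g$ group-like, $\Delta(x)=x\otimes 1+b\otimes x$, $\Delta(y)=y\otimes 1+c\otimes y$, $\varepsilon(x)=\varepsilon(y)=0$. Suppose from now on that $\delta$ exists. Then: 1. $\{g x^i y^j\mid g\in G,\ i,j\ge 0\}$ is a $K$-basis of $H$. 2. If $\beta(1-bc)=0$ (that is, $\beta=0$ or $c=b^{-1}$), then $H\cong H(G,\chi,\eta,b,c,0)$ as Hopf algebras. If $\beta(1-bc)\ne 0$, then necessarily $\eta=\chi^{-1}$, and $H\cong H(G,\chi,\chi^{-1},b,c,1)$ as Hopf algebras. 3. If $G$ is polycyclic-by-finite, then $H$ is (left and right) Noetherian. 4. $H$ is a domain if and only if $K[G]$ is a domain. 5. If $G$ is finitely generated and $\mathrm{GKdim}\,K[G]=d<\infty$, then $H$ is a finitely generated algebra and $\mathrm{GKdim}\,H=d+2$. 6. The antipode $S$ of $H$ satisfies $S^2(g)=g$ for all $g\in G$, $S^2(x)=\chi(b)x$ and $S^2(y)=\eta(c)y$. In particular, $S$ has finite order if and only if $\chi(b)$ and $\eta(c)$ are roots of unity. 7. $H$ is pointed (every simple subcoalgebra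 is one-dimensional), and its group-like elements are exactly the elements of $G$. -/

import Mathlib

open scoped TensorProduct

/-- The data `(σ, δ)` of an Ore extension of the `K`-algebra `R`: an automorphism `σ` and a
(left) `σ`-derivation `δ`. -/
structure OreData (K R : Type*) [Field K] [Ring R] [Algebra K R] where
  σ : R ≃ₐ[K] R
  δ : R →ₗ[K] R
  leibniz : ∀ r s : R, δ (r * s) = σ r * δ s + δ r * s

/-- The Ore extension `R[x; σ, δ]`: the free left `R`-module with basis `x ^ i`, `i : ℕ`, whose
multiplication (defined below) satisfies `x r = σ r x + δ r`. The finitely supported function `f`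
stands for `∑ i, f i • x ^ i`. -/
def OreExtension {K R : Type*} [Field K] [Ring R] [Algebra K R] (_D : OreData K R) : Type _ :=
  ℕ →₀ R

namespace OreExtension

section Construction

variable {K R : Type*} [Field K] [Ring R] [Algebra K R] (D : OreData K R)

noncomputable instance : AddCommGroup (OreExtension D) := inferInstanceAs (AddCommGroup (ℕ →₀ R))
noncomputable instance : Module K (OreExtension D) := inferInstanceAs (Module K (ℕ →₀ R))
noncomputable instance : Module R (OreExtension D) := inferInstanceAs (Module R (ℕ →₀ R))
instance : IsScalarTower K R (OreExtension D) := inferInstanceAs (IsScalarTower K R (ℕ →₀ R))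
instance : SMulCommClass K R (OreExtension D) := inferInstanceAs (SMulCommClass K R (ℕ →₀ R))

/-- The monomial `r x ^ i`. -/
noncomputable def monomial (i : ℕ) : R →ₗ[K] OreExtension D :=
  (Finsupp.lsingle i : R →ₗ[K] ℕ →₀ R)

/-- Left multiplication by `x`: `x (r x ^ i) = σ r x ^ (i + 1) + δ r x ^ i`. -/
noncomputable def mulX : OreExtension D →ₗ[K] OreExtension D :=
  Finsupp.lsum K (M := R) (N := OreExtension D) fun i =>
    (monomial D (i + 1)).comp D.σ.toLinearMap + (monomial D i).comp D.δ

/-- Left multiplication by `∑ i, r i • x ^ i`, as the operator `g ↦ ∑ i, r i • mulX ^ i g`. -/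
noncomputable def mulLeft : OreExtension D →ₗ[K] Module.End K (OreExtension D) :=
  Finsupp.lsum K (M := R) (N := Module.End K (OreExtension D)) fun i =>
    (LinearMap.mulRight K (mulX D ^ i)).comp (Algebra.lsmul K K (OreExtension D)).toLinearMap

variable {D} in
theorem induction {p : OreExtension D → Prop} (f : OreExtension D) (h0 : p 0)
    (hadd : ∀ f g, p f → p g → p (f + g)) (hmon : ∀ i r, p (monomial D i r)) : p f :=
  Finsupp.induction_linear (motive := p) f h0 hadd hmon

theorem mulX_monomial (i : ℕ) (r : R) :
    mulX D (monomial D i r) = monomial D (i + 1) (D.σ r) + monomial D i (D.δ r) :=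
  (Finsupp.lsum_single K _ i r)

theorem mulLeft_monomial (i : ℕ) (r : R) :
    mulLeft D (monomial D i r) = Algebra.lsmul K K (OreExtension D) r * mulX D ^ i :=
  (Finsupp.lsum_single K _ i r)

theorem smul_monomial (i : ℕ) (r s : R) : r • monomial D i s = monomial D i (r * s) :=
  Finsupp.smul_single r i s

theorem δ_one : D.δ 1 = 0 := by
  have := D.leibniz 1 1
  simpa using this

theorem mulX_pow_one (i : ℕ) : (mulX D ^ i) (monomial D 0 1) = monomial D i 1 := by
  induction i with
  | zero => simp
  | succ n ih => rw [pow_succ', Module.End.mul_apply, ih, mulX_monomial]; simp [δ_one]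

theorem mulLeft_smul (r : R) (f : OreExtension D) :
    mulLeft D (r • f) = Algebra.lsmul K K (OreExtension D) r * mulLeft D f := by
  induction f using induction with
  | h0 => simp
  | hadd f g hf hg => rw [smul_add, map_add, map_add, hf, hg, mul_add]
  | hmon i s => rw [smul_monomial, mulLeft_monomial, mulLeft_monomial, map_mul, mul_assoc]

theorem mulX_mul_lsmul (r : R) :
    mulX D * Algebra.lsmul K K (OreExtension D) r =
      Algebra.lsmul K K (OreExtension D) (D.σ r) * mulX D +
        Algebra.lsmul K K (OreExtension D) (D.δ r) := by
  ext f
  induction f using induction with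
  | h0 => simp
  | hadd f g hf hg => rw [map_add, map_add, hf, hg]
  | hmon i s =>
    simp only [Module.End.mul_apply, LinearMap.add_apply, Algebra.lsmul_coe, smul_monomial,
      mulX_monomial, map_mul, D.leibniz, map_add, add_assoc]

theorem mulLeft_mulX (f : OreExtension D) : mulLeft D (mulX D f) = mulX D * mulLeft D f := by
  induction f using induction with
  | h0 => simp
  | hadd f g hf hg => rw [map_add, map_add, map_add, hf, hg, mul_add]
  | hmon i s =>
    rw [mulX_monomial, map_add, mulLeft_monomial, mulLeft_monomial, mulLeft_monomial, ← mul_assoc,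
      mulX_mul_lsmul, add_mul, pow_succ', ← mul_assoc]

theorem mulLeft_mulX_pow (i : ℕ) (f : OreExtension D) :
    mulLeft D ((mulX D ^ i) f) = mulX D ^ i * mulLeft D f := by
  induction i with
  | zero => simp
  | succ n ih => rw [pow_succ', Module.End.mul_apply, mulLeft_mulX, ih, mul_assoc]

theorem mulLeft_mulLeft (f g : OreExtension D) :
    mulLeft D (mulLeft D f g) = mulLeft D f * mulLeft D g := by
  induction f using induction with
  | h0 => simp
  | hadd f₁ f₂ h₁ h₂ => simp only [map_add, LinearMap.add_apply, h₁, h₂, add_mul]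
  | hmon i s =>
    rw [mulLeft_monomial, Module.End.mul_apply, Algebra.lsmul_coe, mulLeft_smul,
      mulLeft_mulX_pow, mul_assoc]

theorem mulLeft_one : mulLeft D (monomial D 0 1) = 1 := by
  rw [mulLeft_monomial, map_one, pow_zero, mul_one]

theorem mulLeft_apply_one (f : OreExtension D) : mulLeft D f (monomial D 0 1) = f := by
  induction f using induction with
  | h0 => simp
  | hadd f₁ f₂ h₁ h₂ => rw [map_add, LinearMap.add_apply, h₁, h₂]
  | hmon i s =>
    rw [mulLeft_monomial, Module.End.mul_apply, mulX_pow_one]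
    exact (smul_monomial D i s 1).trans (by rw [mul_one])

noncomputable instance : Ring (OreExtension D) :=
  { (inferInstance : AddCommGroup (OreExtension D)) with
    mul := fun f g => mulLeft D f g
    one := monomial D 0 1
    mul_assoc := fun f g h => congrArg (fun T => T h) (mulLeft_mulLeft D f g)
    one_mul := fun f => congrArg (fun T => T f) (mulLeft_one D)
    mul_one := fun f => mulLeft_apply_one D f
    left_distrib := fun f g h => map_add (mulLeft D f) g h
    right_distrib := fun f g h => congrArg (fun T => T h) (map_add (mulLeft D) f g)
    zero_mul := fun f => congrArg (fun T => T f) (map_zero (mulLeft D))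
    mul_zero := fun f => map_zero (mulLeft D f) }

theorem mul_def (f g : OreExtension D) : f * g = mulLeft D f g := rfl

theorem one_def : (1 : OreExtension D) = monomial D 0 1 := rfl

noncomputable instance : Algebra K (OreExtension D) :=
  Algebra.ofModule
    (fun k f g => by simp only [mul_def, map_smul, LinearMap.smul_apply])
    (fun k f g => by simp only [mul_def, map_smul])

/-- The inclusion of the coefficient ring. -/
noncomputable def C : R →ₐ[K] OreExtension D :=
  AlgHom.ofLinearMap (monomial D 0) rfl fun r s => by
    rw [mul_def, mulLeft_monomial, pow_zero, mul_one]
    exact (smul_monomial D 0 r s).symm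

/-- The variable `x`. -/
noncomputable def X : OreExtension D := monomial D 1 1

theorem C_mul (r : R) (f : OreExtension D) : C D r * f = r • f := by
  change mulLeft D (monomial D 0 r) f = _
  rw [mulLeft_monomial, pow_zero, mul_one, Algebra.lsmul_coe]

theorem X_mul (f : OreExtension D) : X D * f = mulX D f := by
  change mulLeft D (monomial D 1 1) f = _
  rw [mulLeft_monomial, pow_one, map_one, one_mul]

/-- The defining relation of the Ore extension. -/
theorem X_mul_C (r : R) : X D * C D r = C D (D.σ r) * X D + C D (D.δ r) := by
  rw [X_mul, C_mul]
  change mulX D (monomial D 0 r) = D.σ r • monomial D 1 1 + monomial D 0 (D.δ r)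
  rw [mulX_monomial, smul_monomial, mul_one]

theorem X_pow (i : ℕ) : X D ^ i = monomial D i 1 := by
  induction i with
  | zero => rfl
  | succ n ih => rw [pow_succ', ih, X_mul, mulX_monomial]; simp [δ_one]

/-- Every monomial is `r x ^ i`; so `OreExtension D` is a free left `R`-module on the `x ^ i`. -/
theorem monomial_eq (i : ℕ) (r : R) : monomial D i r = C D r * X D ^ i := by
  rw [X_pow, C_mul, smul_monomial, mul_one]

variable {D}

section Lift

variable {B : Type*} [Ring B] [Algebra K B]

/-- The universal property of the Ore extension. -/
noncomputable def lift (f : R →ₐ[K] B) (t : B)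
    (h : ∀ r, t * f r = f (D.σ r) * t + f (D.δ r)) : OreExtension D →ₐ[K] B :=
  let φ : OreExtension D →ₗ[K] B := Finsupp.lsum K (M := R) (N := B) fun i =>
    (LinearMap.mulRight K (t ^ i)).comp f.toLinearMap
  have hφ : ∀ i r, φ (monomial D i r) = f r * t ^ i := fun i r => Finsupp.lsum_single K _ i r
  have h1 : ∀ g, φ (mulX D g) = t * φ g := fun g => by
    induction g using induction with
    | h0 => simp
    | hadd g₁ g₂ h₁ h₂ => simp only [map_add, h₁, h₂, mul_add]
    | hmon i r =>
      rw [mulX_monomial, map_add, hφ, hφ, hφ, ← mul_assoc, h, add_mul, pow_succ', mul_assoc]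
  have h2 : ∀ i g, φ ((mulX D ^ i) g) = t ^ i * φ g := fun i g => by
    induction i with
    | zero => simp
    | succ n ih => rw [pow_succ', Module.End.mul_apply, h1, ih, pow_succ', mul_assoc]
  have h3 : ∀ (r : R) g, φ (r • g) = f r * φ g := fun r g => by
    induction g using induction with
    | h0 => simp
    | hadd g₁ g₂ h₁ h₂ => simp only [smul_add, map_add, h₁, h₂, mul_add]
    | hmon i s => rw [smul_monomial, hφ, hφ, map_mul, mul_assoc]
  AlgHom.ofLinearMap φ (by rw [one_def, hφ]; simp) fun g g' => by
    induction g using induction with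
    | h0 => simp
    | hadd g₁ g₂ h₁ h₂ => simp only [map_add, add_mul, h₁, h₂]
    | hmon i r =>
      rw [mul_def, mulLeft_monomial, Module.End.mul_apply, Algebra.lsmul_coe, h3, h2, hφ, mul_assoc]

theorem lift_monomial (f : R →ₐ[K] B) (t : B) (h) (i : ℕ) (r : R) :
    lift (D := D) f t h (monomial D i r) = f r * t ^ i :=
  (Finsupp.lsum_single K _ i r)

@[simp] theorem lift_C (f : R →ₐ[K] B) (t : B) (h) (r : R) :
    lift (D := D) f t h (C D r) = f r :=
  (lift_monomial f t h 0 r).trans (by simp)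

@[simp] theorem lift_X (f : R →ₐ[K] B) (t : B) (h) : lift (D := D) f t h (X D) = t :=
  (lift_monomial f t h 1 1).trans (by simp)

theorem algHom_ext {φ ψ : OreExtension D →ₐ[K] B} (hC : φ.comp (C D) = ψ.comp (C D))
    (hX : φ (X D) = ψ (X D)) : φ = ψ := by
  ext f
  induction f using induction with
  | h0 => simp
  | hadd f g hf hg => rw [map_add, map_add, hf, hg]
  | hmon i r =>
    rw [monomial_eq, map_mul, map_mul, map_pow, map_pow, hX]
    congr 1
    exact DFunLike.congr_fun hC r

/-- It suffices to check the hypothesis of `lift` on algebra generators. -/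
theorem lift_cond_of_adjoin {s : Set R} (hs : Algebra.adjoin K s = ⊤) (f : R →ₐ[K] B) (t : B)
    (h : ∀ r ∈ s, t * f r = f (D.σ r) * t + f (D.δ r)) (r : R) :
    t * f r = f (D.σ r) * t + f (D.δ r) := by
  have hr : r ∈ Algebra.adjoin K s := hs ▸ Algebra.mem_top
  induction hr using Algebra.adjoin_induction with
  | mem r hr => exact h r hr
  | algebraMap k =>
    have h1 : D.δ (algebraMap K R k) = 0 := by
      rw [Algebra.algebraMap_eq_smul_one, map_smul, δ_one, smul_zero]
    rw [h1, map_zero, add_zero, AlgEquiv.commutes, AlgHom.commutes, Algebra.commutes]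
  | add a b _ _ ha hb => simp only [map_add, mul_add, add_mul, ha, hb]; abel
  | mul a b _ _ ha hb =>
    rw [D.leibniz, map_mul, map_mul, map_add, map_mul, map_mul, ← mul_assoc, ha, add_mul,
      mul_assoc, hb, map_mul]
    noncomm_ring

variable (D) in
theorem adjoin_eq_top {s : Set R} (hs : Algebra.adjoin K s = ⊤) :
    Algebra.adjoin K (insert (X D) (C D '' s)) = ⊤ := by
  rw [eq_top_iff]
  rintro f -
  have hC : ∀ r, C D r ∈ Algebra.adjoin K (insert (X D) (C D '' s)) := fun r => by
    have : C D r ∈ (Algebra.adjoin K s).map (C D) := by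
      rw [hs]; exact ⟨r, Algebra.mem_top, rfl⟩
    rw [AlgHom.map_adjoin] at this
    exact Algebra.adjoin_mono (Set.subset_insert _ _) this
  induction f using induction with
  | h0 => exact zero_mem _
  | hadd f g hf hg => exact add_mem hf hg
  | hmon i r =>
    rw [monomial_eq]
    exact mul_mem (hC r) (pow_mem (Algebra.subset_adjoin (Set.mem_insert _ _)) i)

end Lift

end Construction

end OreExtension

/-- The parameters of `H(G, χ, η, b, c, β)`: two `K`-valued characters `χ, η` of `G`, two central
elements `b, c` with `η(b) = χ(c)⁻¹`, and a scalar `β`. -/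
structure HParams (K G : Type*) [Field K] [Group G] where
  χ : G →* Kˣ
  η : G →* Kˣ
  b : Subgroup.center G
  c : Subgroup.center G
  compat : η b = (χ c)⁻¹
  β : K

namespace HParams

variable {K G : Type*} [Field K] [Group G]

/-- The automorphism `g ↦ ψ(g) g` of `K[G]`, that is, the winding automorphism `τ_ψ`. -/
noncomputable def windHom (ψ : G →* Kˣ) : MonoidAlgebra K G →ₐ[K] MonoidAlgebra K G :=
  MonoidAlgebra.lift K (MonoidAlgebra K G) G
    { toFun := fun g => (ψ g : K) • MonoidAlgebra.of K G g
      map_one' := by rw [map_one, map_one, Units.val_one, one_smul]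
      map_mul' := fun g h => by
        rw [map_mul, map_mul, Units.val_mul, smul_mul_smul_comm] }

theorem windHom_of (ψ : G →* Kˣ) (g : G) :
    windHom ψ (MonoidAlgebra.of K G g) = (ψ g : K) • MonoidAlgebra.of K G g :=
  MonoidAlgebra.lift_of _ _

theorem groupAlgHom_ext {B : Type*} [Semiring B] [Algebra K B] {f f' : MonoidAlgebra K G →ₐ[K] B}
    (h : ∀ g, f (MonoidAlgebra.of K G g) = f' (MonoidAlgebra.of K G g)) : f = f' :=
  (MonoidAlgebra.lift K B G).symm.injective (MonoidHom.ext h)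

theorem adjoin_of : Algebra.adjoin K (Set.range (MonoidAlgebra.of K G)) = ⊤ := by
  rw [eq_top_iff]
  rintro f -
  induction f using MonoidAlgebra.induction_on with
  | of g => exact Algebra.subset_adjoin ⟨g, rfl⟩
  | add x y hx hy => exact add_mem hx hy
  | smul r x hx => exact Subalgebra.smul_mem _ hx r

theorem windHom_comp (ψ φ : G →* Kˣ) (h : ψ * φ = 1) :
    (windHom ψ).comp (windHom φ) = AlgHom.id K (MonoidAlgebra K G) := by
  refine groupAlgHom_ext fun g => ?_
  have : (φ g : K) * ψ g = 1 := by
    rw [mul_comm, ← Units.val_mul, ← MonoidHom.mul_apply, h, MonoidHom.one_apply, Units.val_one]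
  rw [AlgHom.comp_apply, windHom_of, map_smul, windHom_of, smul_smul, this, one_smul]; rfl

/-- The winding automorphism `τ_ψ` of `K[G]`, given by `g ↦ ψ(g) g`. -/
noncomputable def wind (ψ : G →* Kˣ) : MonoidAlgebra K G ≃ₐ[K] MonoidAlgebra K G :=
  AlgEquiv.ofAlgHom (windHom ψ) (windHom ψ⁻¹) (windHom_comp _ _ (mul_inv_cancel ψ))
    (windHom_comp _ _ (inv_mul_cancel ψ))

theorem wind_of (ψ : G →* Kˣ) (g : G) :
    wind ψ (MonoidAlgebra.of K G g) = (ψ g : K) • MonoidAlgebra.of K G g :=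
  windHom_of ψ g

/-- The data `(τ_χ, 0)` of the first Ore extension. -/
noncomputable def oreX (P : HParams K G) : OreData K (MonoidAlgebra K G) where
  σ := wind P.χ
  δ := 0
  leibniz := by simp

/-- The first Ore extension `A = K[G][x; τ_χ]`. -/
abbrev A (P : HParams K G) : Type _ := OreExtension P.oreX

/-- For a character `ψ` of `G` and a scalar `u`, the endomorphism of `A` with `g ↦ ψ(g) g` and
`x ↦ u x`. -/
noncomputable def windHomA (P : HParams K G) (ψ : G →* Kˣ) (u : Kˣ) : P.A →ₐ[K] P.A :=
  OreExtension.lift ((OreExtension.C P.oreX).comp (windHom ψ)) ((u : K) • OreExtension.X P.oreX)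
    (OreExtension.lift_cond_of_adjoin adjoin_of _ _ (by
      rintro _ ⟨g, rfl⟩
      have h1 : P.oreX.σ (MonoidAlgebra.of K G g) = (P.χ g : K) • MonoidAlgebra.of K G g :=
        wind_of _ _
      have h2 : OreExtension.X P.oreX * OreExtension.C P.oreX (MonoidAlgebra.of K G g) =
          (P.χ g : K) •
            (OreExtension.C P.oreX (MonoidAlgebra.of K G g) * OreExtension.X P.oreX) := by
        rw [OreExtension.X_mul_C, h1, map_smul, smul_mul_assoc]
        exact (congrArg _ (map_zero _)).trans (add_zero _)
      have h3 : P.oreX.δ (MonoidAlgebra.of K G g) = 0 := rfl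
      rw [h1, h3, map_zero, add_zero, map_smul, AlgHom.comp_apply, windHom_of, map_smul]
      simp only [smul_mul_assoc, mul_smul_comm, h2, smul_smul]
      congr 1
      ring))

theorem windHomA_C (P : HParams K G) (ψ : G →* Kˣ) (u : Kˣ) (r : MonoidAlgebra K G) :
    P.windHomA ψ u (OreExtension.C P.oreX r) = OreExtension.C P.oreX (windHom ψ r) :=
  OreExtension.lift_C _ _ _ r

theorem windHomA_X (P : HParams K G) (ψ : G →* Kˣ) (u : Kˣ) :
    P.windHomA ψ u (OreExtension.X P.oreX) = (u : K) • OreExtension.X P.oreX :=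
  OreExtension.lift_X _ _ _

theorem windHomA_comp (P : HParams K G) (ψ φ : G →* Kˣ) (u v : Kˣ) (h : ψ * φ = 1)
    (h' : u * v = 1) : (P.windHomA ψ u).comp (P.windHomA φ v) = AlgHom.id K P.A := by
  refine OreExtension.algHom_ext ?_ ?_
  · refine AlgHom.ext fun r => ?_
    simp only [AlgHom.comp_apply, windHomA_C]
    rw [← AlgHom.comp_apply (windHom ψ), windHom_comp _ _ h]; rfl
  · have : (v : K) * u = 1 := by rw [mul_comm, ← Units.val_mul, h', Units.val_one]
    rw [AlgHom.comp_apply, windHomA_X, map_smul, windHomA_X, smul_smul, this, one_smul]; rfl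

/-- The winding automorphism `τ_η` of `A` (for `η` extended by `η(x) = 0`): it is given by
`g ↦ η(g) g` and `x ↦ η(b) x`. -/
noncomputable def windA (P : HParams K G) : P.A ≃ₐ[K] P.A :=
  AlgEquiv.ofAlgHom (P.windHomA P.η (P.η P.b)) (P.windHomA P.η⁻¹ (P.η P.b)⁻¹)
    (P.windHomA_comp _ _ _ _ (mul_inv_cancel P.η) (mul_inv_cancel _))
    (P.windHomA_comp _ _ _ _ (inv_mul_cancel P.η) (inv_mul_cancel _))

/-- The element `β (1 - c b)` of `K[G]`. -/
noncomputable def e (P : HParams K G) : MonoidAlgebra K G :=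
  P.β • (1 - MonoidAlgebra.of K G P.c * MonoidAlgebra.of K G P.b)

/-- A `τ_η`-derivation `δ` of `A = K[G][x; τ_χ]` with `δ = 0` on `K[G]` and `δ(x) = β (1 - c b)`. -/
structure Deriv (P : HParams K G) where
  δ : P.A →ₗ[K] P.A
  leibniz : ∀ r s, δ (r * s) = P.windA r * δ s + δ r * s
  map_group : ∀ g : G, δ (OreExtension.C P.oreX (MonoidAlgebra.of K G g)) = 0
  map_X : δ (OreExtension.X P.oreX) = OreExtension.C P.oreX P.e

/-- The data `(τ_η, δ)` of the second Ore extension. -/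
noncomputable def oreY (P : HParams K G) (d : P.Deriv) : OreData K P.A where
  σ := P.windA
  δ := d.δ
  leibniz := d.leibniz

/-- The derivation is determined by its defining values, so that `H` below depends only on `P`. -/
instance (P : HParams K G) : Subsingleton P.Deriv := by
  refine ⟨fun d d' => ?_⟩
  have key : ∀ a, d.δ a = d'.δ a := fun a => by
    have ha : a ∈ Algebra.adjoin K (insert (OreExtension.X P.oreX)
        (OreExtension.C P.oreX '' Set.range (MonoidAlgebra.of K G))) := by
      rw [OreExtension.adjoin_eq_top _ adjoin_of]; exact Algebra.mem_top
    induction ha using Algebra.adjoin_induction with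
    | mem r hr =>
      obtain rfl | ⟨_, ⟨g, rfl⟩, rfl⟩ := hr
      · rw [d.map_X, d'.map_X]
      · rw [d.map_group, d'.map_group]
    | algebraMap k =>
      have h1 := OreExtension.δ_one (P.oreY d)
      have h2 := OreExtension.δ_one (P.oreY d')
      rw [Algebra.algebraMap_eq_smul_one, map_smul, map_smul]
      exact (congrArg _ h1).trans (congrArg _ h2.symm)
    | add x y _ _ hx hy => rw [map_add, map_add, hx, hy]
    | mul x y _ _ hx hy => rw [d.leibniz, d'.leibniz, hx, hy]
  cases d; cases d'
  congr
  exact LinearMap.ext key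

/-- The algebra `H(G, χ, η, b, c, β) = K[G][x; τ_χ][y; τ_η, δ]`. -/
abbrev H (P : HParams K G) (d : P.Deriv) : Type _ := OreExtension (P.oreY d)

section Generators

variable (P : HParams K G) (d : P.Deriv)

/-- The inclusion of `K[G]` in `H`. -/
noncomputable def ι : MonoidAlgebra K G →ₐ[K] P.H d :=
  (OreExtension.C (P.oreY d)).comp (OreExtension.C P.oreX)

/-- The element `g` of `H`, for `g ∈ G`. -/
noncomputable def gen : G →* P.H d :=
  (P.ι d : MonoidAlgebra K G →* P.H d).comp (MonoidAlgebra.of K G)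

/-- The generator `x` of `H`. -/
noncomputable def x : P.H d := OreExtension.C (P.oreY d) (OreExtension.X P.oreX)

/-- The generator `y` of `H`. -/
noncomputable def y : P.H d := OreExtension.X (P.oreY d)

theorem x_mul_gen (g : G) : P.x d * P.gen d g = (P.χ g : K) • (P.gen d g * P.x d) := by
  have h : OreExtension.X P.oreX * OreExtension.C P.oreX (MonoidAlgebra.of K G g) =
      (P.χ g : K) • (OreExtension.C P.oreX (MonoidAlgebra.of K G g) * OreExtension.X P.oreX) := by
    rw [OreExtension.X_mul_C, show P.oreX.σ (MonoidAlgebra.of K G g) = _ from wind_of _ _, map_smul,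
      smul_mul_assoc]
    exact (congrArg _ (map_zero _)).trans (add_zero _)
  have := congrArg (OreExtension.C (P.oreY d)) h
  rw [map_smul, map_mul, map_mul] at this
  exact this

theorem y_mul_gen (g : G) : P.y d * P.gen d g = (P.η g : K) • (P.gen d g * P.y d) := by
  have h := OreExtension.X_mul_C (P.oreY d) (OreExtension.C P.oreX (MonoidAlgebra.of K G g))
  have h1 : (P.oreY d).δ (OreExtension.C P.oreX (MonoidAlgebra.of K G g)) = 0 := d.map_group g
  have h2 : (P.oreY d).σ (OreExtension.C P.oreX (MonoidAlgebra.of K G g)) =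
      (P.η g : K) • OreExtension.C P.oreX (MonoidAlgebra.of K G g) :=
    (P.windHomA_C _ _ _).trans (by rw [windHom_of, map_smul])
  rw [h1, h2, map_zero, add_zero, map_smul, smul_mul_assoc] at h
  exact h

theorem y_mul_x : P.y d * P.x d = (P.η P.b : K) • (P.x d * P.y d) + P.ι d P.e := by
  have h := OreExtension.X_mul_C (P.oreY d) (OreExtension.X P.oreX)
  have h1 : (P.oreY d).δ (OreExtension.X P.oreX) = OreExtension.C P.oreX P.e := d.map_X
  have h2 : (P.oreY d).σ (OreExtension.X P.oreX) = (P.η P.b : K) • OreExtension.X P.oreX :=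
    P.windHomA_X _ _
  rw [h1, h2, map_smul, smul_mul_assoc] at h
  exact h

theorem ι_e : P.ι d P.e = P.β • (1 - P.gen d P.c * P.gen d P.b) := by
  simp only [e, map_smul, map_sub, map_one, map_mul]; rfl

theorem adjoin_gen_eq_top :
    Algebra.adjoin K ({P.y d, P.x d} ∪ Set.range (P.gen d)) = ⊤ := by
  rw [← OreExtension.adjoin_eq_top (P.oreY d) (OreExtension.adjoin_eq_top P.oreX adjoin_of)]
  congr 1
  rw [Set.image_insert_eq, ← Set.image_comp, ← Set.range_comp]
  ext t
  simp only [Set.mem_union, Set.mem_insert_iff, Set.mem_singleton_iff, or_assoc]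
  rfl

/-- Algebra homomorphisms out of `A` from the images of the generators. -/
noncomputable def liftA {B : Type*} [Ring B] [Algebra K B] (f : G →* B) (s : B)
    (h1 : ∀ g, s * f g = (P.χ g : K) • (f g * s)) : P.A →ₐ[K] B :=
  OreExtension.lift (MonoidAlgebra.lift K B G f) s
    (OreExtension.lift_cond_of_adjoin adjoin_of _ _ (Set.forall_mem_range.mpr fun g => by
      have e1 : P.oreX.σ (MonoidAlgebra.of K G g) = (P.χ g : K) • MonoidAlgebra.of K G g :=
        wind_of _ _
      have e3 : P.oreX.δ (MonoidAlgebra.of K G g) = 0 := rfl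
      rw [e1, e3, map_zero, add_zero, map_smul, MonoidAlgebra.lift_of, smul_mul_assoc, h1]))

theorem liftA_of {B : Type*} [Ring B] [Algebra K B] (f : G →* B) (s : B) (h1) (g : G) :
    P.liftA f s h1 (OreExtension.C P.oreX (MonoidAlgebra.of K G g)) = f g :=
  (OreExtension.lift_C _ _ _ _).trans (MonoidAlgebra.lift_of _ _)

theorem liftA_X {B : Type*} [Ring B] [Algebra K B] (f : G →* B) (s : B) (h1) :
    P.liftA f s h1 (OreExtension.X P.oreX) = s :=
  OreExtension.lift_X _ _ _

theorem liftA_e {B : Type*} [Ring B] [Algebra K B] (f : G →* B) (s : B) (h1) :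
    P.liftA f s h1 (OreExtension.C P.oreX P.e) = P.β • (1 - f P.c * f P.b) := by
  rw [e, map_smul, map_smul, map_sub, map_sub, map_one, map_one, map_mul, map_mul, liftA_of,
    liftA_of]

variable {d} in
/-- Algebra homomorphisms out of `H` from the images of the generators. -/
noncomputable def liftH {B : Type*} [Ring B] [Algebra K B] (f : G →* B) (s t : B)
    (h1 : ∀ g, s * f g = (P.χ g : K) • (f g * s)) (h2 : ∀ g, t * f g = (P.η g : K) • (f g * t))
    (h3 : t * s = (P.η P.b : K) • (s * t) + P.β • (1 - f P.c * f P.b)) : P.H d →ₐ[K] B :=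
  OreExtension.lift (P.liftA f s h1) t
    (OreExtension.lift_cond_of_adjoin (OreExtension.adjoin_eq_top P.oreX adjoin_of) _ _
      (Set.forall_mem_insert.mpr ⟨by
        have e1 : (P.oreY d).δ (OreExtension.X P.oreX) = OreExtension.C P.oreX P.e := d.map_X
        have e2 : (P.oreY d).σ (OreExtension.X P.oreX) = (P.η P.b : K) • OreExtension.X P.oreX :=
          P.windHomA_X _ _
        rw [e1, e2, map_smul, liftA_X, liftA_e, h3, smul_mul_assoc],
      Set.forall_mem_image.mpr (Set.forall_mem_range.mpr fun g => by
        have e1 : (P.oreY d).δ (OreExtension.C P.oreX (MonoidAlgebra.of K G g)) = 0 :=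
          d.map_group g
        have e2 : (P.oreY d).σ (OreExtension.C P.oreX (MonoidAlgebra.of K G g)) =
            (P.η g : K) • OreExtension.C P.oreX (MonoidAlgebra.of K G g) :=
          (P.windHomA_C _ _ _).trans (by rw [windHom_of, map_smul])
        rw [e1, e2, map_zero, add_zero, map_smul, liftA_of, h2, smul_mul_assoc])⟩))

variable {B : Type*} [Ring B] [Algebra K B] (f : G →* B) (s t : B)

@[simp] theorem liftH_gen (h1 h2 h3) (g : G) : P.liftH (d := d) f s t h1 h2 h3 (P.gen d g) = f g :=
  (OreExtension.lift_C _ _ _ _).trans (P.liftA_of _ _ _ g)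

@[simp] theorem liftH_x (h1 h2 h3) : P.liftH (d := d) f s t h1 h2 h3 (P.x d) = s :=
  (OreExtension.lift_C _ _ _ _).trans (P.liftA_X _ _ _)

@[simp] theorem liftH_y (h1 h2 h3) : P.liftH (d := d) f s t h1 h2 h3 (P.y d) = t :=
  OreExtension.lift_X _ _ _

variable {P d} in
theorem algHom_ext {B : Type*} [Ring B] [Algebra K B] {φ ψ : P.H d →ₐ[K] B}
    (hg : ∀ g, φ (P.gen d g) = ψ (P.gen d g)) (hx : φ (P.x d) = ψ (P.x d))
    (hy : φ (P.y d) = ψ (P.y d)) : φ = ψ :=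
  OreExtension.algHom_ext (OreExtension.algHom_ext (groupAlgHom_ext hg) hx) hy

end Generators

section Hopf

variable (P : HParams K G) (d : P.Deriv)

theorem gen_comm (z : Subgroup.center G) (g : G) :
    P.gen d z * P.gen d g = P.gen d g * P.gen d z := by
  rw [← map_mul, ← map_mul, (Subgroup.mem_center_iff.mp z.2 g)]

/-- The comultiplication: `Δ g = g ⊗ g`, `Δ x = x ⊗ 1 + b ⊗ x`, `Δ y = y ⊗ 1 + c ⊗ y`. -/
noncomputable def comulHom : P.H d →ₐ[K] P.H d ⊗[K] P.H d :=
  P.liftH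
    { toFun := fun g => P.gen d g ⊗ₜ[K] P.gen d g
      map_one' := by rw [map_one]; rfl
      map_mul' := fun g h => by rw [map_mul, Algebra.TensorProduct.tmul_mul_tmul] }
    (P.x d ⊗ₜ[K] 1 + P.gen d P.b ⊗ₜ[K] P.x d) (P.y d ⊗ₜ[K] 1 + P.gen d P.c ⊗ₜ[K] P.y d)
    (fun g => by
      simp only [MonoidHom.coe_mk, OneHom.coe_mk, add_mul, mul_add,
        Algebra.TensorProduct.tmul_mul_tmul, x_mul_gen, gen_comm, one_mul, mul_one, smul_add,
        TensorProduct.smul_tmul', TensorProduct.tmul_smul])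
    (fun g => by
      simp only [MonoidHom.coe_mk, OneHom.coe_mk, add_mul, mul_add,
        Algebra.TensorProduct.tmul_mul_tmul, y_mul_gen, gen_comm, one_mul, mul_one, smul_add,
        TensorProduct.smul_tmul', TensorProduct.tmul_smul])
    (by
      have hq : (P.η P.b : K) * (P.χ P.c : K) = 1 := by
        rw [P.compat, ← Units.val_mul, inv_mul_cancel, Units.val_one]
      simp only [MonoidHom.coe_mk, OneHom.coe_mk, add_mul, mul_add,
        Algebra.TensorProduct.tmul_mul_tmul, x_mul_gen, y_mul_gen, y_mul_x, ι_e, one_mul, mul_one,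
        smul_add, TensorProduct.smul_tmul', TensorProduct.tmul_smul, TensorProduct.add_tmul,
        TensorProduct.tmul_add, smul_smul, hq, one_smul, smul_sub, TensorProduct.sub_tmul,
        TensorProduct.tmul_sub, gen_comm P d P.c, Algebra.TensorProduct.one_def]
      abel)

@[simp] theorem comulHom_gen (g : G) : P.comulHom d (P.gen d g) = P.gen d g ⊗ₜ[K] P.gen d g :=
  P.liftH_gen _ _ _ _ _ _ _ g

@[simp] theorem comulHom_x :
    P.comulHom d (P.x d) = P.x d ⊗ₜ[K] 1 + P.gen d P.b ⊗ₜ[K] P.x d :=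
  P.liftH_x _ _ _ _ _ _ _

@[simp] theorem comulHom_y :
    P.comulHom d (P.y d) = P.y d ⊗ₜ[K] 1 + P.gen d P.c ⊗ₜ[K] P.y d :=
  P.liftH_y _ _ _ _ _ _ _

/-- The counit: `ε g = 1`, `ε x = 0`, `ε y = 0`. -/
noncomputable def counitHom : P.H d →ₐ[K] K :=
  P.liftH 1 0 0 (by simp) (by simp) (by simp)

@[simp] theorem counitHom_gen (g : G) : P.counitHom d (P.gen d g) = 1 :=
  P.liftH_gen _ _ _ _ _ _ _ g

@[simp] theorem counitHom_x : P.counitHom d (P.x d) = 0 :=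
  P.liftH_x _ _ _ _ _ _ _

@[simp] theorem counitHom_y : P.counitHom d (P.y d) = 0 :=
  P.liftH_y _ _ _ _ _ _ _

noncomputable instance : Bialgebra K (P.H d) :=
  Bialgebra.ofAlgHom (P.comulHom d) (P.counitHom d)
    (by
      refine algHom_ext (fun g => ?_) ?_ ?_ <;>
      simp [TensorProduct.add_tmul, TensorProduct.tmul_add, Algebra.TensorProduct.one_def,
        add_assoc])
    (by refine algHom_ext (fun g => ?_) ?_ ?_ <;> simp)
    (by refine algHom_ext (fun g => ?_) ?_ ?_ <;> simp)

theorem comul_def (a : P.H d) : Coalgebra.comul (R := K) a = P.comulHom d a := rfl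

theorem counit_def (a : P.H d) : Coalgebra.counit (R := K) a = P.counitHom d a := rfl

theorem gen_inv_mul (g : G) : P.gen d g⁻¹ * P.gen d g = 1 := by
  rw [← map_mul, inv_mul_cancel, map_one]

theorem gen_mul_inv (g : G) : P.gen d g * P.gen d g⁻¹ = 1 := by
  rw [← map_mul, mul_inv_cancel, map_one]

theorem x_mul_gen_inv (g : G) :
    (P.χ g : K) • (P.x d * P.gen d g⁻¹) = P.gen d g⁻¹ * P.x d := by
  rw [x_mul_gen, smul_smul, ← Units.val_mul, ← map_mul, mul_inv_cancel, map_one, Units.val_one,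
    one_smul]

theorem y_mul_gen_inv (g : G) :
    (P.η g : K) • (P.y d * P.gen d g⁻¹) = P.gen d g⁻¹ * P.y d := by
  rw [y_mul_gen, smul_smul, ← Units.val_mul, ← map_mul, mul_inv_cancel, map_one, Units.val_one,
    one_smul]

theorem gen_inv_comm (z : Subgroup.center G) (g : G) :
    P.gen d g * P.gen d (z : G)⁻¹ = P.gen d (z : G)⁻¹ * P.gen d g :=
  (P.gen_comm d z⁻¹ g).symm

theorem antipode_rel :
    P.gen d (P.b : G)⁻¹ * P.x d * (P.gen d (P.c : G)⁻¹ * P.y d) =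
      (P.η P.b : K) • (P.gen d (P.c : G)⁻¹ * P.y d * (P.gen d (P.b : G)⁻¹ * P.x d)) +
        P.β • (1 - P.gen d (P.b : G)⁻¹ * P.gen d (P.c : G)⁻¹) := by
  have hq : ((P.χ (P.c : G)⁻¹ : Kˣ) : K) = P.η P.b := by rw [P.compat, map_inv]
  have hcc : P.gen d (P.c : G)⁻¹ * P.gen d (P.b : G)⁻¹ =
      P.gen d (P.b : G)⁻¹ * P.gen d (P.c : G)⁻¹ := P.gen_inv_comm d P.b _
  have hu : P.gen d (P.b : G)⁻¹ * P.gen d (P.c : G)⁻¹ * (P.gen d P.c * P.gen d P.b) = 1 := by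
    rw [mul_assoc, ← mul_assoc (P.gen d (P.c : G)⁻¹), gen_inv_mul, one_mul, gen_inv_mul]
  have h1 : P.gen d (P.b : G)⁻¹ * P.x d * (P.gen d (P.c : G)⁻¹ * P.y d) =
      (P.η P.b : K) • (P.gen d (P.b : G)⁻¹ * P.gen d (P.c : G)⁻¹ * (P.x d * P.y d)) := by
    rw [mul_assoc, ← mul_assoc (P.x d), x_mul_gen, hq]
    simp only [smul_mul_assoc, mul_smul_comm, mul_assoc]
  have h2 : (P.η P.b : K) • (P.gen d (P.c : G)⁻¹ * P.y d * (P.gen d (P.b : G)⁻¹ * P.x d)) =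
      P.gen d (P.b : G)⁻¹ * P.gen d (P.c : G)⁻¹ * (P.y d * P.x d) := by
    rw [mul_assoc, ← mul_assoc (P.y d), ← mul_smul_comm, ← smul_mul_assoc, y_mul_gen_inv, ← hcc]
    simp only [mul_assoc]
  rw [h1, h2, y_mul_x, ι_e, mul_add, mul_smul_comm, mul_smul_comm, mul_sub, mul_one, hu,
    smul_sub, smul_sub]
  abel

open MulOpposite in
/-- The antipode as an algebra homomorphism `H → Hᵒᵖ`: `S g = g⁻¹`, `S x = -b⁻¹ x`,
`S y = -c⁻¹ y`. -/
noncomputable def antipodeHom : P.H d →ₐ[K] (P.H d)ᵐᵒᵖ :=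
  P.liftH
    { toFun := fun g => op (P.gen d g⁻¹)
      map_one' := by rw [inv_one, map_one]; rfl
      map_mul' := fun g h => by rw [mul_inv_rev, map_mul, op_mul] }
    (op (-(P.gen d (P.b : G)⁻¹ * P.x d))) (op (-(P.gen d (P.c : G)⁻¹ * P.y d)))
    (fun g => by
      apply unop_injective
      simp only [MonoidHom.coe_mk, OneHom.coe_mk, unop_mul, unop_op, unop_smul, mul_neg, neg_mul,
        smul_neg]
      rw [mul_assoc, ← mul_smul_comm, x_mul_gen_inv, ← mul_assoc, ← mul_assoc, gen_inv_comm])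
    (fun g => by
      apply unop_injective
      simp only [MonoidHom.coe_mk, OneHom.coe_mk, unop_mul, unop_op, unop_smul, mul_neg, neg_mul,
        smul_neg]
      rw [mul_assoc, ← mul_smul_comm, y_mul_gen_inv, ← mul_assoc, ← mul_assoc, gen_inv_comm])
    (by
      apply unop_injective
      simp only [MonoidHom.coe_mk, OneHom.coe_mk, unop_mul, unop_op, unop_smul, unop_add,
        unop_sub, unop_one, neg_mul_neg]
      exact P.antipode_rel d)

theorem antipodeHom_gen (g : G) :
    P.antipodeHom d (P.gen d g) = MulOpposite.op (P.gen d g⁻¹) :=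
  P.liftH_gen _ _ _ _ _ _ _ g

theorem antipodeHom_x :
    P.antipodeHom d (P.x d) = MulOpposite.op (-(P.gen d (P.b : G)⁻¹ * P.x d)) :=
  P.liftH_x _ _ _ _ _ _ _

theorem antipodeHom_y :
    P.antipodeHom d (P.y d) = MulOpposite.op (-(P.gen d (P.c : G)⁻¹ * P.y d)) :=
  P.liftH_y _ _ _ _ _ _ _

/-- The antipode of `H`. -/
noncomputable def antipodeMap : P.H d →ₗ[K] P.H d :=
  (MulOpposite.opLinearEquiv K).symm.toLinearMap ∘ₗ (P.antipodeHom d).toLinearMap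

theorem antipodeMap_mul (a a' : P.H d) :
    P.antipodeMap d (a * a') = P.antipodeMap d a' * P.antipodeMap d a :=
  congrArg MulOpposite.unop (map_mul (P.antipodeHom d) a a')

@[simp] theorem antipodeMap_gen (g : G) : P.antipodeMap d (P.gen d g) = P.gen d g⁻¹ :=
  congrArg MulOpposite.unop (P.antipodeHom_gen d g)

@[simp] theorem antipodeMap_x : P.antipodeMap d (P.x d) = -(P.gen d (P.b : G)⁻¹ * P.x d) :=
  congrArg MulOpposite.unop (P.antipodeHom_x d)

@[simp] theorem antipodeMap_y : P.antipodeMap d (P.y d) = -(P.gen d (P.c : G)⁻¹ * P.y d) :=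
  congrArg MulOpposite.unop (P.antipodeHom_y d)

@[simp] theorem antipodeMap_one : P.antipodeMap d 1 = 1 :=
  congrArg MulOpposite.unop (map_one (P.antipodeHom d))

theorem antipode_left (a : P.H d) :
    LinearMap.mul' K (P.H d) ((P.antipodeMap d).rTensor (P.H d) (P.comulHom d a)) =
      algebraMap K (P.H d) (P.counitHom d a) := by
  have key : ∀ u w : P.H d ⊗[K] P.H d, ∀ k : K,
      LinearMap.mul' K (P.H d) ((P.antipodeMap d).rTensor (P.H d) u) = algebraMap K (P.H d) k →
      LinearMap.mul' K (P.H d) ((P.antipodeMap d).rTensor (P.H d) (u * w)) =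
        k • LinearMap.mul' K (P.H d) ((P.antipodeMap d).rTensor (P.H d) w) := by
    intro u w k hk
    induction w using TensorProduct.induction_on with
    | zero => simp
    | add w₁ w₂ h₁ h₂ => rw [mul_add, map_add, map_add, h₁, h₂, map_add, map_add, smul_add]
    | tmul p q =>
      have : ∀ u : P.H d ⊗[K] P.H d,
          LinearMap.mul' K (P.H d) ((P.antipodeMap d).rTensor (P.H d) (u * p ⊗ₜ[K] q)) =
          P.antipodeMap d p *
            LinearMap.mul' K (P.H d) ((P.antipodeMap d).rTensor (P.H d) u) * q := by
        intro u
        induction u using TensorProduct.induction_on with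
        | zero => simp
        | add u₁ u₂ h₁ h₂ =>
          rw [add_mul, map_add, map_add, h₁, h₂, map_add, map_add, mul_add, add_mul]
        | tmul r s => simp [antipodeMap_mul, mul_assoc]
      rw [this, hk, ← Algebra.commutes, mul_assoc, Algebra.smul_def]
      simp
  have ha : a ∈ Algebra.adjoin K ({P.y d, P.x d} ∪ Set.range (P.gen d)) := by
    rw [adjoin_gen_eq_top]; exact Algebra.mem_top
  induction ha using Algebra.adjoin_induction with
  | mem r hr =>
    obtain (rfl | rfl) | ⟨g, rfl⟩ := hr
    · simp
    · simp
    · simp [gen_inv_mul]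
  | algebraMap k =>
    simp [Algebra.algebraMap_eq_smul_one, TensorProduct.smul_tmul',
      Algebra.TensorProduct.one_def]
  | add r s _ _ hr hs => simp only [map_add, hr, hs]
  | mul r s _ _ hr hs => rw [map_mul, key _ _ _ hr, hs, map_mul, map_mul, Algebra.smul_def]

theorem antipode_right (a : P.H d) :
    LinearMap.mul' K (P.H d) ((P.antipodeMap d).lTensor (P.H d) (P.comulHom d a)) =
      algebraMap K (P.H d) (P.counitHom d a) := by
  have key : ∀ u w : P.H d ⊗[K] P.H d, ∀ k : K,
      LinearMap.mul' K (P.H d) ((P.antipodeMap d).lTensor (P.H d) u) = algebraMap K (P.H d) k →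
      LinearMap.mul' K (P.H d) ((P.antipodeMap d).lTensor (P.H d) (w * u)) =
        k • LinearMap.mul' K (P.H d) ((P.antipodeMap d).lTensor (P.H d) w) := by
    intro u w k hk
    induction w using TensorProduct.induction_on with
    | zero => simp
    | add w₁ w₂ h₁ h₂ => rw [add_mul, map_add, map_add, h₁, h₂, map_add, map_add, smul_add]
    | tmul p q =>
      have : ∀ u : P.H d ⊗[K] P.H d,
          LinearMap.mul' K (P.H d) ((P.antipodeMap d).lTensor (P.H d) (p ⊗ₜ[K] q * u)) =
          p * LinearMap.mul' K (P.H d) ((P.antipodeMap d).lTensor (P.H d) u) *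
            P.antipodeMap d q := by
        intro u
        induction u using TensorProduct.induction_on with
        | zero => simp
        | add u₁ u₂ h₁ h₂ =>
          rw [mul_add, map_add, map_add, h₁, h₂, map_add, map_add, mul_add, add_mul]
        | tmul r s => simp [antipodeMap_mul, mul_assoc]
      rw [this, hk, ← Algebra.commutes, mul_assoc, Algebra.smul_def]
      simp
  have ha : a ∈ Algebra.adjoin K ({P.y d, P.x d} ∪ Set.range (P.gen d)) := by
    rw [adjoin_gen_eq_top]; exact Algebra.mem_top
  induction ha using Algebra.adjoin_induction with
  | mem r hr =>
    obtain (rfl | rfl) | ⟨g, rfl⟩ := hr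
    · simp [← mul_assoc, gen_mul_inv]
    · simp [← mul_assoc, gen_mul_inv]
    · simp [gen_mul_inv]
  | algebraMap k =>
    simp [Algebra.algebraMap_eq_smul_one, TensorProduct.smul_tmul',
      Algebra.TensorProduct.one_def]
  | add r s _ _ hr hs => simp only [map_add, hr, hs]
  | mul r s _ _ hr hs =>
    rw [map_mul, key _ _ _ hs, hr, map_mul, map_mul, Algebra.smul_def, Algebra.commutes]

/-- The Hopf algebra `H(G, χ, η, b, c, β)`. -/
noncomputable instance : HopfAlgebra K (P.H d) where
  antipode := P.antipodeMap d
  mul_antipode_rTensor_comul := LinearMap.ext (P.antipode_left d)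
  mul_antipode_lTensor_comul := LinearMap.ext (P.antipode_right d)

end Hopf

end HParams

/-- The Gelfand–Kirillov dimension
`sup_V limsup_n log (dim (K + V + ⋯ + V ^ n)) / log n`, with `V` running over the
finite-dimensional subspaces; note that `(K + V) ^ n = K + V + ⋯ + V ^ n`. -/
noncomputable def GKdim (K R : Type*) [Field K] [Ring R] [Algebra K R] : EReal :=
  ⨆ (V : Submodule K R) (_ : V.FG),
    Filter.limsup
      (fun n : ℕ =>
        ((Real.log (Module.finrank K ((1 ⊔ V) ^ n : Submodule K R)) / Real.log n : ℝ) : EReal))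
      Filter.atTop

/-- A polycyclic group: it has a finite subnormal series with cyclic factors. -/
def IsPolycyclic (G : Type*) [Group G] : Prop :=
  ∃ (n : ℕ) (s : ℕ → Subgroup G), s 0 = ⊥ ∧ s n = ⊤ ∧
    ∀ i < n, s i ≤ s (i + 1) ∧
      ∃ _ : ((s i).subgroupOf (s (i + 1))).Normal,
        IsCyclic (s (i + 1) ⧸ (s i).subgroupOf (s (i + 1)))

/-- A polycyclic-by-finite group: it has a polycyclic normal subgroup of finite index. -/
def IsPolycyclicByFinite (G : Type*) [Group G] : Prop :=
  ∃ N : Subgroup G, N.Normal ∧ N.FiniteIndex ∧ IsPolycyclic N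

section Pointed

variable (K : Type*) {C : Type*} [Field K] [AddCommGroup C] [Module K C] [Coalgebra K C]

/-- A subspace `D` with `Δ(D) ⊆ D ⊗ D`. -/
def IsSubcoalgebra (D : Submodule K C) : Prop :=
  ∀ a ∈ D, Coalgebra.comul (R := K) a ∈ LinearMap.range (TensorProduct.mapIncl D D)

/-- A nonzero subcoalgebra without subcoalgebras other than `0` and itself. -/
def IsSimpleSubcoalgebra (D : Submodule K C) : Prop :=
  IsSubcoalgebra K D ∧ D ≠ ⊥ ∧ ∀ E ≤ D, IsSubcoalgebra K E → E = ⊥ ∨ E = D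

variable (C) in
/-- A pointed coalgebra: every simple subcoalgebra is one-dimensional. -/
def IsPointedCoalgebra : Prop :=
  ∀ D : Submodule K C, IsSimpleSubcoalgebra K D → Module.finrank K D = 1

end Pointed

/-!
The existence of `δ` is decided by applying it to `x g = χ(g) g x`: since `e = β (1 - c b)` is
central in `K[G]`, this forces `e = 0` or `χ η = 1`. Conversely, in these cases there is an algebra
homomorphism from `A` to upper triangular `2 × 2` matrices over `A` with diagonal `(τ_η, id)`, and
`δ` is its off-diagonal entry (`HParams.derivMatrix`). The basis is that of an iterated Ore
extension, and the isomorphisms rescale `x` (`HParams.nonempty_bialgEquiv`).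

An Ore extension by an automorphism inherits being a domain, by comparing leading coefficients
(`OreExtension.isDomain`), and being left Noetherian, by Hilbert's argument with leading
coefficients of `x ^ n` twisted by `σ ^ (-n)` (`OreExtension.isNoetherianRing`). The same theorem
handles polycyclic groups: if `H / N` is cyclic, generated by the class of `t`, every element of
`K[H]` is a unit times an element of the image of `K[N][x; conj t]`. A finite extension of groups
makes a finite extension of group algebras. Right Noetherianity of the Hopf algebra follows because
its antipode is a surjection onto the opposite ring. The square of the antipode is an algebra
endomorphism that is diagonal on the generators `g`, `x`, `y`, which decides when the antipode has
finite order.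

For the Gelfand–Kirillov dimension, let `S` be a finite subset of `G` containing `1`, `b`, `c`, and
`Y` the span of `S`, `x`, `y`. Straightening a word of length `n` never increases its length, as
`y x` is replaced by a combination of `x y`, `1` and `c b`; hence `Y ^ n` has dimension at most
`|S ^ n| (n + 1) ^ 2`. By the monomial basis, `Y ^ (3 n)` has at least that dimension. Since the
growth of `K[G]` is that of `|S ^ n|`, taking logarithms gives the summand `2`.

Finally, a nonzero subcoalgebra contains a group element: if `g x ^ i y ^ j` occurs in `a` with
`i + j` maximal, contracting the right tensor factor of `Δ a` with its coordinate leaves a nonzero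
multiple of `g b ^ i c ^ j` (`HParams.exists_gen_mem`). Pointedness and the description of the
group-like elements both follow.
-/

/-! ### Ore extensions: degree, domains, Hilbert's basis theorem -/

namespace OreExtension

section Degree

variable {K R : Type*} [Field K] [Ring R] [Algebra K R] (D : OreData K R)

/-- The coefficient of `x ^ i`, for coefficients written on the left. -/
noncomputable def coeff (i : ℕ) : OreExtension D →ₗ[R] R :=
  (Finsupp.lapply i : (ℕ →₀ R) →ₗ[R] R)

/-- The elements of degree less than `n`, as a left `R`-submodule. -/
noncomputable def degreeLT (n : ℕ) : Submodule R (OreExtension D) :=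
  ⨅ (i : ℕ) (_ : n ≤ i), LinearMap.ker (coeff D i)

variable {D}

theorem mem_degreeLT {n : ℕ} {f : OreExtension D} :
    f ∈ degreeLT D n ↔ ∀ i, n ≤ i → coeff D i f = 0 := by
  simp [degreeLT]

theorem degreeLT_mono : Monotone (degreeLT D) := fun _ _ h _ hf =>
  mem_degreeLT.2 fun i hi => mem_degreeLT.1 hf i (h.trans hi)

theorem ext_coeff {f g : OreExtension D} (h : ∀ i, coeff D i f = coeff D i g) : f = g :=
  Finsupp.ext h

theorem coeff_monomial (i j : ℕ) (r : R) :
    coeff D i (monomial D j r) = if j = i then r else 0 :=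
  Finsupp.single_apply

theorem exists_mem_degreeLT (f : OreExtension D) : ∃ n, f ∈ degreeLT D n := by
  induction f using induction with
  | h0 => exact ⟨0, zero_mem _⟩
  | hadd f g hf hg =>
    obtain ⟨m, hm⟩ := hf
    obtain ⟨n, hn⟩ := hg
    exact ⟨max m n, add_mem (degreeLT_mono (le_max_left _ _) hm)
      (degreeLT_mono (le_max_right _ _) hn)⟩
  | hmon i r =>
    refine ⟨i + 1, mem_degreeLT.2 fun j hj => ?_⟩
    rw [coeff_monomial, if_neg (by omega)]

theorem eq_zero_of_mem_degreeLT_zero {f : OreExtension D} (hf : f ∈ degreeLT D 0) : f = 0 :=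
  ext_coeff fun i => (mem_degreeLT.1 hf i i.zero_le).trans (map_zero _).symm

theorem mem_degreeLT_of_coeff_eq_zero {n : ℕ} {f : OreExtension D} (hf : f ∈ degreeLT D (n + 1))
    (h : coeff D n f = 0) : f ∈ degreeLT D n := by
  refine mem_degreeLT.2 fun i hi => ?_
  obtain rfl | hi := hi.eq_or_lt
  · exact h
  · exact mem_degreeLT.1 hf i hi

theorem exists_leadingCoeff {f : OreExtension D} (hf : f ≠ 0) :
    ∃ n, f ∈ degreeLT D (n + 1) ∧ coeff D n f ≠ 0 := by
  classical
  have hex := exists_mem_degreeLT f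
  have hspec := Nat.find_spec hex
  cases hn : Nat.find hex with
  | zero => exact absurd (eq_zero_of_mem_degreeLT_zero (hn ▸ hspec)) hf
  | succ n =>
    rw [hn] at hspec
    exact ⟨n, hspec, fun h => Nat.find_min hex (m := n) (by omega)
      (mem_degreeLT_of_coeff_eq_zero hspec h)⟩

theorem coeff_mulX_succ (i : ℕ) (f : OreExtension D) :
    coeff D (i + 1) (mulX D f) = D.σ (coeff D i f) + D.δ (coeff D (i + 1) f) := by
  induction f using induction with
  | h0 => simp
  | hadd f g hf hg => simp only [map_add, hf, hg]; abel
  | hmon j r =>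
    rw [mulX_monomial, map_add]
    simp only [coeff_monomial, Nat.add_right_cancel_iff]
    split_ifs <;> simp

theorem X_pow_mul_mem_degreeLT {n : ℕ} (m : ℕ) {f : OreExtension D} (hf : f ∈ degreeLT D n) :
    X D ^ m * f ∈ degreeLT D (m + n) := by
  induction m with
  | zero => simpa using hf
  | succ m ih =>
    rw [pow_succ', mul_assoc, X_mul]
    refine mem_degreeLT.2 fun i hi => ?_
    obtain ⟨i, rfl⟩ : ∃ j, i = j + 1 := ⟨i - 1, by omega⟩
    rw [coeff_mulX_succ, mem_degreeLT.1 ih i (by omega), mem_degreeLT.1 ih (i + 1) (by omega),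
      map_zero, map_zero, add_zero]

theorem coeff_X_pow_mul {n : ℕ} (m : ℕ) {f : OreExtension D} (hf : f ∈ degreeLT D (n + 1)) :
    coeff D (m + n) (X D ^ m * f) = (D.σ ^ m) (coeff D n f) := by
  induction m with
  | zero => simp
  | succ m ih =>
    rw [pow_succ', mul_assoc, X_mul, Nat.succ_add, coeff_mulX_succ, ih,
      mem_degreeLT.1 (X_pow_mul_mem_degreeLT m hf) _ (by omega), map_zero, add_zero, pow_succ']
    rfl

theorem sub_monomial_mem_degreeLT {m : ℕ} {f : OreExtension D} (hf : f ∈ degreeLT D (m + 1)) :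
    f - monomial D m (coeff D m f) ∈ degreeLT D m := by
  refine mem_degreeLT.2 fun i hi => ?_
  rw [map_sub, coeff_monomial]
  split_ifs with h
  · rw [h, sub_self]
  · rw [mem_degreeLT.1 hf i (by omega), sub_zero]

theorem mul_mem_degreeLT {m n : ℕ} {f g : OreExtension D} (hf : f ∈ degreeLT D m)
    (hg : g ∈ degreeLT D (n + 1)) : f * g ∈ degreeLT D (m + n) := by
  induction m generalizing f with
  | zero => rw [eq_zero_of_mem_degreeLT_zero hf, zero_mul]; exact zero_mem _
  | succ m ih =>
    rw [← sub_add_cancel f (monomial D m (coeff D m f)), add_mul]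
    refine add_mem (degreeLT_mono (by omega) (ih (sub_monomial_mem_degreeLT hf))) ?_
    rw [monomial_eq, mul_assoc, C_mul]
    exact Submodule.smul_mem _ _ (degreeLT_mono (by omega) (X_pow_mul_mem_degreeLT m hg))

/-- The leading coefficient of a product. -/
theorem coeff_mul {m n : ℕ} {f g : OreExtension D} (hf : f ∈ degreeLT D (m + 1))
    (hg : g ∈ degreeLT D (n + 1)) :
    coeff D (m + n) (f * g) = coeff D m f * (D.σ ^ m) (coeff D n g) := by
  conv_lhs => rw [← sub_add_cancel f (monomial D m (coeff D m f)), add_mul, map_add,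
    mem_degreeLT.1 (mul_mem_degreeLT (sub_monomial_mem_degreeLT hf) hg) _ le_rfl, zero_add,
    monomial_eq, mul_assoc, C_mul, map_smul, coeff_X_pow_mul m hg, smul_eq_mul]

variable (D) in
theorem noZeroDivisors [NoZeroDivisors R] : NoZeroDivisors (OreExtension D) := by
  refine ⟨fun {f g} h => ?_⟩
  by_contra! hfg
  obtain ⟨m, hm, hm'⟩ := exists_leadingCoeff hfg.1
  obtain ⟨n, hn, hn'⟩ := exists_leadingCoeff hfg.2
  have := coeff_mul hm hn
  rw [h, map_zero] at this
  exact (mul_ne_zero hm' ((map_ne_zero_iff _ (D.σ ^ m).injective).2 hn')) this.symm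

variable (D) in
theorem C_injective : Function.Injective (C D) :=
  Finsupp.single_injective 0

variable (D) in
theorem isDomain [IsDomain R] : IsDomain (OreExtension D) :=
  have := noZeroDivisors D
  have := (C_injective D).nontrivial
  NoZeroDivisors.to_isDomain _

end Degree

section Noetherian

variable {K R : Type*} [Field K] [Ring R] [Algebra K R] {D : OreData K R}

theorem isNoetherian_degreeLT [IsNoetherianRing R] (n : ℕ) : IsNoetherian R (degreeLT D n) := by
  refine isNoetherian_of_injective
    ((LinearMap.pi fun i : Fin n => coeff D i).comp (degreeLT D n).subtype) ?_
  rw [← LinearMap.ker_eq_bot, LinearMap.ker_eq_bot']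
  rintro ⟨f, hf⟩ h
  refine Subtype.ext (ext_coeff fun i => ?_)
  obtain hi | hi := lt_or_ge i n
  · exact (congrFun h ⟨i, hi⟩).trans (map_zero _).symm
  · exact (mem_degreeLT.1 hf i hi).trans (map_zero _).symm

/-- For a left ideal `I`, the elements `σ ^ (-n) a`, where `a` runs over the coefficients of
`x ^ n` in the elements of `I` of degree at most `n`. The twist by `σ ^ (-n)` makes these left
ideals increase with `n`, because `x (a x ^ n) = σ a x ^ (n + 1) + δ a x ^ n`. -/
def leadingIdeal (I : Ideal (OreExtension D)) (n : ℕ) : Ideal R where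
  carrier := {a | ∃ f ∈ I, f ∈ degreeLT D (n + 1) ∧ coeff D n f = (D.σ ^ n) a}
  zero_mem' := ⟨0, zero_mem _, zero_mem _, by simp⟩
  add_mem' := by
    rintro a b ⟨f, hf, hf', hfa⟩ ⟨g, hg, hg', hgb⟩
    exact ⟨f + g, add_mem hf hg, add_mem hf' hg', by rw [map_add, map_add, hfa, hgb]⟩
  smul_mem' := by
    rintro r a ⟨f, hf, hf', hfa⟩
    refine ⟨C D ((D.σ ^ n) r) * f, I.mul_mem_left _ hf, ?_, ?_⟩
    · rw [C_mul]; exact Submodule.smul_mem _ _ hf'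
    · rw [C_mul, map_smul, hfa, smul_eq_mul, smul_eq_mul, map_mul]

theorem leadingIdeal_mono (I : Ideal (OreExtension D)) : Monotone (leadingIdeal I) := by
  refine monotone_nat_of_le_succ fun n a => ?_
  rintro ⟨f, hf, hf', hfa⟩
  refine ⟨X D ^ 1 * f, I.mul_mem_left _ hf, ?_, ?_⟩
  · exact degreeLT_mono (by omega) (X_pow_mul_mem_degreeLT 1 hf')
  · rw [add_comm n 1, coeff_X_pow_mul 1 hf', hfa, pow_add]; rfl

variable (D) in
/-- Hilbert's basis theorem for Ore extensions. -/
theorem isNoetherianRing [IsNoetherianRing R] : IsNoetherianRing (OreExtension D) := by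
  rw [isNoetherianRing_iff_ideal_fg]
  intro I
  obtain ⟨N, hN⟩ := monotone_stabilizes_iff_noetherian.2 (inferInstance : IsNoetherian R R)
    ⟨leadingIdeal I, leadingIdeal_mono I⟩
  -- `I` is generated by its elements of degree at most `N`, which form a Noetherian `R`-module.
  let M : Submodule R (OreExtension D) :=
    { carrier := {f | f ∈ I ∧ f ∈ degreeLT D (N + 1)}
      zero_mem' := ⟨zero_mem _, zero_mem _⟩
      add_mem' := fun hf hg => ⟨add_mem hf.1 hg.1, add_mem hf.2 hg.2⟩
      smul_mem' := fun r f hf => ⟨by rw [← C_mul]; exact I.mul_mem_left _ hf.1,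
        Submodule.smul_mem _ _ hf.2⟩ }
  obtain ⟨s, hs⟩ : M.FG := isNoetherian_submodule.1 (isNoetherian_degreeLT (D := D) (N + 1)) M
    fun f hf => hf.2
  have hsM : ∀ f ∈ M, f ∈ Ideal.span (s : Set (OreExtension D)) := fun f hf => by
    rw [← hs] at hf
    refine Submodule.span_induction (p := fun f _ => f ∈ Ideal.span (s : Set (OreExtension D)))
      (fun f hf => Ideal.subset_span hf) (zero_mem _) (fun f g _ _ => add_mem) ?_ hf
    intro r f _ hf
    rw [← C_mul]
    exact Ideal.mul_mem_left _ _ hf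
  refine ⟨s, le_antisymm ?_ ?_⟩
  · refine Ideal.span_le.2 fun f hf => ?_
    have : f ∈ M := hs ▸ Submodule.subset_span hf
    exact this.1
  have key : ∀ n, ∀ f ∈ I, f ∈ degreeLT D n → f ∈ Ideal.span (s : Set (OreExtension D)) := by
    intro n
    induction n with
    | zero => intro f _ hf; rw [eq_zero_of_mem_degreeLT_zero hf]; exact zero_mem _
    | succ n ih =>
      intro f hfI hf
      obtain hn | hn := le_or_gt n N
      · exact hsM f ⟨hfI, degreeLT_mono (by omega) hf⟩
      -- Subtract from `f` a multiple `x ^ (n - N) g`, with `g ∈ I` of degree `N`.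
      have ha : (D.σ ^ n).symm (coeff D n f) ∈ leadingIdeal I n :=
        ⟨f, hfI, hf, by rw [AlgEquiv.apply_symm_apply]⟩
      have hNn : leadingIdeal I N = leadingIdeal I n := hN n hn.le
      rw [← hNn] at ha
      obtain ⟨g, hgI, hg, hgf⟩ := ha
      obtain ⟨k, rfl⟩ : ∃ k, n = k + N := ⟨n - N, by omega⟩
      have h1 : X D ^ k * g ∈ Ideal.span (s : Set (OreExtension D)) :=
        Ideal.mul_mem_left _ _ (hsM g ⟨hgI, hg⟩)
      have h4 : f - X D ^ k * g ∈ I := I.sub_mem hfI (I.mul_mem_left _ hgI)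
      suffices h5 : f - X D ^ k * g ∈ degreeLT D (k + N) by
        have := Ideal.add_mem _ (ih _ h4 h5) h1
        rwa [sub_add_cancel] at this
      have h3 : X D ^ k * g ∈ degreeLT D (k + N + 1) :=
        degreeLT_mono (le_of_eq (add_assoc k N 1).symm) (X_pow_mul_mem_degreeLT k hg)
      refine mem_degreeLT_of_coeff_eq_zero (Submodule.sub_mem _ hf h3) ?_
      rw [map_sub, coeff_X_pow_mul k hg, hgf, sub_eq_zero]
      have h2 (r : R) : (D.σ ^ k) ((D.σ ^ N) r) = (D.σ ^ (k + N)) r := by rw [pow_add]; rfl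
      rw [h2, AlgEquiv.apply_symm_apply]
  intro f hf
  obtain ⟨n, hn⟩ := exists_mem_degreeLT f
  exact key n f hf hn

end Noetherian

end OreExtension

/-! ### Group algebras of polycyclic-by-finite groups are Noetherian -/

section GroupAlgebraNoetherian

variable {K : Type*} [Field K]

/-- Localization step for left Noetherian rings: if every element of `S` becomes, after
multiplication by a unit on the left, the image of an element of a left Noetherian ring `T`, then
`S` is left Noetherian. -/
theorem isNoetherianRing_of_unit_mul_mem_range {T S : Type*} [Ring T] [Ring S]
    [IsNoetherianRing T] (φ : T →+* S) (h : ∀ s : S, ∃ (u : Sˣ) (t : T), u * s = φ t) :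
    IsNoetherianRing S := by
  rw [isNoetherianRing_iff_ideal_fg]
  intro I
  obtain ⟨s, hs⟩ := (isNoetherianRing_iff_ideal_fg T).1 inferInstance (I.comap φ)
  classical
  refine ⟨s.image φ, le_antisymm ?_ fun f hf => ?_⟩
  · rw [Finset.coe_image, Submodule.span_le]
    rintro _ ⟨t, ht, rfl⟩
    have : t ∈ I.comap φ := hs ▸ Submodule.subset_span ht
    exact this
  · obtain ⟨u, t, hut⟩ := h f
    have ht : t ∈ Ideal.span (s : Set T) := by
      rw [hs, Ideal.mem_comap, ← hut]
      exact I.mul_mem_left _ hf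
    have key : φ t ∈ Ideal.span (φ '' (s : Set T)) := by
      rw [← Ideal.map_span]
      exact Ideal.mem_map_of_mem φ ht
    have := Submodule.smul_mem _ ((u⁻¹ : Sˣ) : S) key
    rwa [← hut, smul_eq_mul, Units.inv_mul_cancel_left, ← Finset.coe_image] at this

variable {H : Type*} [Group H]

/-- The data of the skew polynomial ring over the group algebra of a normal subgroup `N`, twisted
by conjugation by `t`. -/
noncomputable def conjOreData (K : Type*) [Field K] {H : Type*} [Group H] (N : Subgroup H)
    [N.Normal] (t : H) : OreData K (MonoidAlgebra K N) where
  σ := MonoidAlgebra.domCongr K K (MulAut.conjNormal t)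
  δ := 0
  leibniz := by simp

theorem conjOreData_σ_of (N : Subgroup H) [N.Normal] (t : H) (n : N) :
    (conjOreData K N t).σ (MonoidAlgebra.of K N n) =
      MonoidAlgebra.of K N (MulAut.conjNormal t n) :=
  MonoidAlgebra.domCongr_single _ _ _

/-- The map from the skew polynomial ring `K[N][x; conj t]` to `K[H]` sending `x` to `t`. -/
noncomputable def skewPolynomialToGroupAlgebra (K : Type*) [Field K] {H : Type*} [Group H]
    (N : Subgroup H) [N.Normal] (t : H) :
    OreExtension (conjOreData K N t) →ₐ[K] MonoidAlgebra K H :=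
  OreExtension.lift (MonoidAlgebra.lift K (MonoidAlgebra K H) N
    ((MonoidAlgebra.of K H).comp N.subtype)) (MonoidAlgebra.of K H t)
    (OreExtension.lift_cond_of_adjoin HParams.adjoin_of _ _ (Set.forall_mem_range.2 fun n => by
      have h0 : (conjOreData K N t).δ (MonoidAlgebra.of K N n) = 0 := rfl
      rw [conjOreData_σ_of, h0, map_zero, add_zero, MonoidAlgebra.lift_of, MonoidAlgebra.lift_of]
      simp only [MonoidHom.comp_apply, ← map_mul]
      simp))

theorem of_mul_zpow_mem_range (N : Subgroup H) [N.Normal] (t : H) (n : N) (k : ℕ) :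
    MonoidAlgebra.of K H (n * t ^ k) ∈ (skewPolynomialToGroupAlgebra K N t).range := by
  refine ⟨OreExtension.C _ (MonoidAlgebra.of K N n) * OreExtension.X _ ^ k, ?_⟩
  change skewPolynomialToGroupAlgebra K N t _ = _
  rw [map_mul, map_pow, skewPolynomialToGroupAlgebra, OreExtension.lift_C, OreExtension.lift_X,
    MonoidAlgebra.lift_of, map_mul, map_pow]
  rfl

theorem exists_of_mul_mem_range (N : Subgroup H) [N.Normal] (t : H)
    (ht : ∀ h : H, ∃ k : ℤ, h * t ^ k ∈ N) (f : MonoidAlgebra K H) :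
    ∃ m : ℕ, ∀ k : ℕ, m ≤ k → MonoidAlgebra.of K H (t ^ k) * f ∈
      (skewPolynomialToGroupAlgebra K N t).range := by
  induction f using MonoidAlgebra.induction_on with
  | of g =>
    obtain ⟨k, hk⟩ := ht g
    refine ⟨k.natAbs, fun l hl => ?_⟩
    rw [← map_mul]
    have h1 : t ^ l * g = (MulAut.conjNormal (H := N) (t ^ l) ⟨_, hk⟩ : H) *
        t ^ (l - k).toNat := by
      rw [MulAut.conjNormal_apply, ← zpow_natCast t (l - k).toNat, Int.toNat_of_nonneg (by omega),
        zpow_sub, zpow_natCast]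
      simp [mul_assoc]
    rw [h1]
    exact of_mul_zpow_mem_range N t _ _
  | add x y hx hy =>
    obtain ⟨m, hm⟩ := hx
    obtain ⟨n, hn⟩ := hy
    refine ⟨max m n, fun k hk => ?_⟩
    rw [mul_add]
    exact add_mem (hm k (le_trans (le_max_left _ _) hk)) (hn k (le_trans (le_max_right _ _) hk))
  | smul r x hx =>
    obtain ⟨m, hm⟩ := hx
    refine ⟨m, fun k hk => ?_⟩
    rw [mul_smul_comm]
    exact Subalgebra.smul_mem _ (hm k hk) r

/-- If `H / N` is cyclic, generated by the class of `t`, then `K[H]` is obtained from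
the image of the skew polynomial ring `K[N][x; conj t]` by inverting `t`. -/
theorem isNoetherianRing_of_cyclic_quotient (N : Subgroup H) [N.Normal] [IsCyclic (H ⧸ N)]
    [IsNoetherianRing (MonoidAlgebra K N)] : IsNoetherianRing (MonoidAlgebra K H) := by
  obtain ⟨q, hq⟩ := IsCyclic.exists_generator (α := H ⧸ N)
  obtain ⟨t, rfl⟩ := QuotientGroup.mk_surjective q
  have ht (h : H) : ∃ k : ℤ, h * t ^ k ∈ N := by
    obtain ⟨k, hk⟩ := Subgroup.mem_zpowers_iff.1 (hq (h : H ⧸ N))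
    refine ⟨-k, ?_⟩
    rw [← QuotientGroup.eq_one_iff, QuotientGroup.mk_mul, QuotientGroup.mk_zpow, ← hk]
    group
  have := OreExtension.isNoetherianRing (conjOreData K N t)
  refine isNoetherianRing_of_unit_mul_mem_range
    (skewPolynomialToGroupAlgebra K N t).toRingHom fun f => ?_
  obtain ⟨m, hm⟩ := exists_of_mul_mem_range N t ht f
  obtain ⟨p, hp⟩ := hm m le_rfl
  exact ⟨Units.map (MonoidAlgebra.of K H) (toUnits (t ^ m)), p, hp.symm⟩

theorem isNoetherianRing_of_finiteIndex (N : Subgroup H) [N.FiniteIndex]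
    [IsNoetherianRing (MonoidAlgebra K N)] : IsNoetherianRing (MonoidAlgebra K H) := by
  let φ : MonoidAlgebra K N →ₐ[K] MonoidAlgebra K H := MonoidAlgebra.mapDomainAlgHom K K N.subtype
  let _ : Module (MonoidAlgebra K N) (MonoidAlgebra K H) := Module.compHom _ φ.toRingHom
  have hsmul (r : MonoidAlgebra K N) (f : MonoidAlgebra K H) : r • f = φ r * f := rfl
  have : IsScalarTower (MonoidAlgebra K N) (MonoidAlgebra K H) (MonoidAlgebra K H) :=
    ⟨fun r f g => by simp only [hsmul, smul_eq_mul, mul_assoc]⟩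
  have hfin : Module.Finite (MonoidAlgebra K N) (MonoidAlgebra K H) := by
    have : Finite (H ⧸ N) := inferInstance
    refine ⟨⟨(Set.finite_range fun q : H ⧸ N => MonoidAlgebra.of K H q.out⁻¹).toFinset, ?_⟩⟩
    rw [Set.Finite.coe_toFinset, eq_top_iff]
    rintro f -
    induction f using MonoidAlgebra.induction_on with
    | of g =>
      obtain ⟨n, hn⟩ := QuotientGroup.mk_out_eq_mul N g⁻¹
      have h1 : MonoidAlgebra.of K H g = MonoidAlgebra.of K N n •
          MonoidAlgebra.of K H (QuotientGroup.mk (s := N) g⁻¹).out⁻¹ := by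
        rw [hsmul, hn]
        have h2 : φ (MonoidAlgebra.of K N n) = MonoidAlgebra.of K H n :=
          MonoidAlgebra.mapDomain_single
        rw [h2, ← map_mul]
        congr 1
        simp
      rw [h1]
      exact Submodule.smul_mem _ _ (Submodule.subset_span ⟨_, rfl⟩)
    | add x y hx hy => exact add_mem hx hy
    | smul r x hx =>
      have h1 : r • x = algebraMap K (MonoidAlgebra K N) r • x := by
        rw [hsmul, AlgHom.commutes, Algebra.smul_def]
      rw [h1]
      exact Submodule.smul_mem _ _ hx
  have : IsNoetherian (MonoidAlgebra K N) (MonoidAlgebra K H) :=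
    isNoetherian_of_isNoetherianRing_of_finite _ _
  exact isNoetherian_of_tower (MonoidAlgebra K N) this

theorem isNoetherianRing_monoidAlgebra_congr {H' : Type*} [Group H'] (e : H ≃* H')
    [IsNoetherianRing (MonoidAlgebra K H)] : IsNoetherianRing (MonoidAlgebra K H') :=
  isNoetherianRing_of_ringEquiv _ (MonoidAlgebra.domCongr K K e).toRingEquiv

theorem IsPolycyclic.isNoetherianRing (hH : IsPolycyclic H) :
    IsNoetherianRing (MonoidAlgebra K H) := by
  obtain ⟨n, s, h0, hn, hs⟩ := hH
  have key (i : ℕ) (hi : i ≤ n) : IsNoetherianRing (MonoidAlgebra K (s i)) := by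
    induction i with
    | zero =>
      rw [h0]
      refine isNoetherianRing_of_surjective K _ (algebraMap K _) fun f => ?_
      refine ⟨f.coeff 1, MonoidAlgebra.ext (Finsupp.ext fun g => ?_)⟩
      rw [Subsingleton.elim g 1]
      simp [MonoidAlgebra.coe_algebraMap]
    | succ i ih =>
      have := ih (by omega)
      obtain ⟨hle, hnormal, hcyc⟩ := hs i (by omega)
      have : IsNoetherianRing (MonoidAlgebra K ((s i).subgroupOf (s (i + 1)))) :=
        isNoetherianRing_monoidAlgebra_congr (Subgroup.subgroupOfEquivOfLe hle).symm
      exact isNoetherianRing_of_cyclic_quotient ((s i).subgroupOf (s (i + 1)))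
  have := key n le_rfl
  rw [hn] at this
  exact isNoetherianRing_monoidAlgebra_congr Subgroup.topEquiv

theorem IsPolycyclicByFinite.isNoetherianRing (hH : IsPolycyclicByFinite H) :
    IsNoetherianRing (MonoidAlgebra K H) := by
  obtain ⟨N, -, hfin, hN⟩ := hH
  have := hN.isNoetherianRing (K := K)
  exact isNoetherianRing_of_finiteIndex N

end GroupAlgebraNoetherian

/-! ### The derivation, the monomial basis and rescaling isomorphisms -/

namespace OreExtension

section Basis

variable {K R ι : Type*} [Field K] [Ring R] [Algebra K R] (D : OreData K R)

/-- The `K`-basis `b i * x ^ n` of an Ore extension, for a `K`-basis `b` of the coefficients. -/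
noncomputable def basis (b : Module.Basis ι K R) : Module.Basis (ι × ℕ) K (OreExtension D) :=
  ((Finsupp.basis fun _ : ℕ => b).reindex
    ((Equiv.sigmaEquivProd ℕ ι).trans (Equiv.prodComm ℕ ι)) :
      Module.Basis (ι × ℕ) K (ℕ →₀ R))

theorem basis_apply (b : Module.Basis ι K R) (i : ι) (n : ℕ) :
    basis D b (i, n) = C D (b i) * X D ^ n := by
  rw [← monomial_eq]
  change ((Finsupp.basis fun _ : ℕ => b).reindex _ : Module.Basis (ι × ℕ) K (ℕ →₀ R)) (i, n) = _
  rw [Module.Basis.reindex_apply, Finsupp.coe_basis]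
  rfl

end Basis

end OreExtension

namespace HParams

variable {K G : Type*} [Field K] [Group G] (P : HParams K G)

theorem e_comm (g : G) :
    P.e * MonoidAlgebra.of K G g = MonoidAlgebra.of K G g * P.e := by
  have hb := Subgroup.mem_center_iff.1 P.b.2 g
  have hc := Subgroup.mem_center_iff.1 P.c.2 g
  have h : (P.c * P.b : G) * g = g * (P.c * P.b) := by
    rw [mul_assoc, ← hb, ← mul_assoc, ← hc, mul_assoc]
  rw [e, smul_mul_assoc, mul_smul_comm, sub_mul, mul_sub, one_mul, mul_one, ← map_mul, ← map_mul,
    ← map_mul, h]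

theorem e_eq_zero_iff : P.e = 0 ↔ P.β = 0 ∨ P.c = P.b⁻¹ := by
  rw [e, smul_eq_zero, sub_eq_zero, ← map_one (MonoidAlgebra.of K G), ← map_mul,
    (MonoidAlgebra.of_injective).eq_iff, eq_comm (a := (1 : G)),
    ← Subgroup.coe_mul, ← Subgroup.coe_one, Subtype.coe_inj, mul_eq_one_iff_eq_inv]

theorem X_mul_of (g : G) :
    OreExtension.X P.oreX * OreExtension.C P.oreX (MonoidAlgebra.of K G g) =
      (P.χ g : K) •
        (OreExtension.C P.oreX (MonoidAlgebra.of K G g) * OreExtension.X P.oreX) := by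
  rw [OreExtension.X_mul_C, show P.oreX.σ (MonoidAlgebra.of K G g) = _ from wind_of _ _, map_smul,
    smul_mul_assoc]
  exact (congrArg _ (map_zero _)).trans (add_zero _)

theorem windA_of (g : G) :
    P.windA (OreExtension.C P.oreX (MonoidAlgebra.of K G g)) =
      (P.η g : K) • OreExtension.C P.oreX (MonoidAlgebra.of K G g) :=
  (P.windHomA_C _ _ _).trans (by rw [windHom_of, map_smul])

theorem windA_X :
    P.windA (OreExtension.X P.oreX) = (P.η P.b : K) • OreExtension.X P.oreX :=
  P.windHomA_X _ _

theorem e_eq_zero_or_of_deriv (d : P.Deriv) : P.e = 0 ∨ P.η = P.χ⁻¹ := by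
  by_contra! h
  obtain ⟨h0, hne⟩ := h
  refine hne (MonoidHom.ext fun g => ?_)
  have h1 := congrArg d.δ (P.X_mul_of g)
  rw [map_smul, d.leibniz, d.leibniz, d.map_group, d.map_X, mul_zero, zero_mul, zero_add, add_zero,
    windA_of, smul_mul_assoc, ← map_mul, ← map_mul, e_comm, ← map_smul, ← map_smul] at h1
  have h2 := OreExtension.C_injective _ h1
  have h3 : MonoidAlgebra.of K G g * P.e ≠ 0 := fun h => h0 <| by
    have := congrArg (MonoidAlgebra.of K G g⁻¹ * ·) h
    simpa only [← mul_assoc, ← map_mul, inv_mul_cancel, map_one, one_mul, mul_zero] using this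
  rw [smul_smul, ← sub_eq_zero, ← one_smul K (MonoidAlgebra.of K G g * P.e), smul_smul,
    ← sub_smul, mul_one, smul_eq_zero, or_iff_left h3, sub_eq_zero] at h2
  rw [MonoidHom.inv_apply, ← mul_eq_one_iff_eq_inv, mul_comm]
  exact Units.ext (by rw [Units.val_mul, ← h2, Units.val_one])

/-- The homomorphism from `A` to upper triangular matrices with diagonal `(τ_η, id)`; its
off-diagonal entry is the `τ_η`-derivation `δ`. -/
noncomputable def derivMatrix (h : P.e = 0 ∨ P.η = P.χ⁻¹) :
    P.A →ₐ[K] Matrix (Fin 2) (Fin 2) P.A :=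
  P.liftA
    { toFun := fun g => !![(P.η g : K) • OreExtension.C P.oreX (MonoidAlgebra.of K G g), 0;
        0, OreExtension.C P.oreX (MonoidAlgebra.of K G g)]
      map_one' := by
        simp only [map_one, Units.val_one, one_smul, Matrix.one_fin_two]
      map_mul' := fun g g' => by
        simp only [map_mul, Units.val_mul, Matrix.mul_fin_two, mul_zero, zero_mul, add_zero,
          zero_add, smul_mul_smul_comm] }
    !![(P.η P.b : K) • OreExtension.X P.oreX, OreExtension.C P.oreX P.e; 0, OreExtension.X P.oreX]
    (fun g => by
      have h1 : OreExtension.C P.oreX P.e * OreExtension.C P.oreX (MonoidAlgebra.of K G g) =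
          (P.χ g : K) • (P.η g : K) •
            (OreExtension.C P.oreX (MonoidAlgebra.of K G g) * OreExtension.C P.oreX P.e) := by
        obtain h | h := h
        · rw [h, map_zero, zero_mul, mul_zero, smul_zero, smul_zero]
        · rw [h, MonoidHom.inv_apply, smul_smul, ← Units.val_mul, mul_inv_cancel, Units.val_one,
            one_smul, ← map_mul, ← map_mul, e_comm]
      simp only [MonoidHom.coe_mk, OneHom.coe_mk, Matrix.mul_fin_two, mul_zero, zero_mul, add_zero,
        zero_add, Matrix.smul_of, Matrix.smul_cons, Matrix.smul_empty, smul_zero, h1, X_mul_of,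
        smul_mul_assoc, mul_smul_comm, smul_smul, mul_comm, mul_left_comm])

theorem derivMatrix_of (h : P.e = 0 ∨ P.η = P.χ⁻¹) (g : G) :
    P.derivMatrix h (OreExtension.C P.oreX (MonoidAlgebra.of K G g)) =
      !![(P.η g : K) • OreExtension.C P.oreX (MonoidAlgebra.of K G g), 0;
        0, OreExtension.C P.oreX (MonoidAlgebra.of K G g)] :=
  P.liftA_of _ _ _ g

theorem derivMatrix_X (h : P.e = 0 ∨ P.η = P.χ⁻¹) :
    P.derivMatrix h (OreExtension.X P.oreX) =
      !![(P.η P.b : K) • OreExtension.X P.oreX, OreExtension.C P.oreX P.e;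
        0, OreExtension.X P.oreX] :=
  P.liftA_X _ _ _

theorem derivMatrix_entries (h : P.e = 0 ∨ P.η = P.χ⁻¹) (a : P.A) :
    P.derivMatrix h a 0 0 = P.windA a ∧ P.derivMatrix h a 1 1 = a := by
  suffices P.derivMatrix h a 0 0 = P.windA a ∧ P.derivMatrix h a 1 1 = a ∧
    P.derivMatrix h a 1 0 = 0 from ⟨this.1, this.2.1⟩
  have ha : a ∈ Algebra.adjoin K (insert (OreExtension.X P.oreX)
      (OreExtension.C P.oreX '' Set.range (MonoidAlgebra.of K G))) := by
    rw [OreExtension.adjoin_eq_top _ adjoin_of]; exact Algebra.mem_top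
  induction ha using Algebra.adjoin_induction with
  | mem r hr =>
    obtain rfl | ⟨_, ⟨g, rfl⟩, rfl⟩ := hr
    · rw [derivMatrix_X, windA_X]; simp
    · rw [derivMatrix_of, windA_of]; simp
  | algebraMap k =>
    rw [AlgHom.commutes, AlgEquiv.commutes]
    simp [Matrix.algebraMap_matrix_apply]
  | add x y _ _ hx hy => simp [hx, hy]
  | mul x y _ _ hx hy => simp [Matrix.mul_apply, Fin.sum_univ_two, hx, hy]

theorem nonempty_deriv_iff : Nonempty P.Deriv ↔ P.e = 0 ∨ P.η = P.χ⁻¹ := by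
  refine ⟨fun ⟨d⟩ => P.e_eq_zero_or_of_deriv d, fun h => ⟨?_⟩⟩
  exact
    { δ := (LinearMap.proj 1).comp ((LinearMap.proj (R := K) (φ := fun _ : Fin 2 => Fin 2 → P.A)
        0).comp (P.derivMatrix h).toLinearMap)
      leibniz := fun r s => by
        change P.derivMatrix h (r * s) 0 1 = P.windA r * P.derivMatrix h s 0 1 +
          P.derivMatrix h r 0 1 * s
        rw [map_mul, Matrix.mul_apply, Fin.sum_univ_two, (P.derivMatrix_entries h r).1,
          (P.derivMatrix_entries h s).2]
      map_group := fun g => by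
        change P.derivMatrix h _ 0 1 = 0
        rw [derivMatrix_of]; rfl
      map_X := by
        change P.derivMatrix h _ 0 1 = _
        rw [derivMatrix_X]; rfl }

variable (d : P.Deriv)

/-- The `K`-basis `g x ^ i y ^ j` of `H`. -/
noncomputable def basis : Module.Basis (G × ℕ × ℕ) K (P.H d) :=
  (OreExtension.basis (P.oreY d) (OreExtension.basis P.oreX (MonoidAlgebra.basis G K))).reindex
    (Equiv.prodAssoc G ℕ ℕ)

theorem basis_apply (g : G) (i j : ℕ) :
    P.basis d (g, i, j) = P.gen d g * P.x d ^ i * P.y d ^ j := by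
  rw [basis, Module.Basis.reindex_apply, Equiv.prodAssoc_symm_apply, OreExtension.basis_apply,
    OreExtension.basis_apply, map_mul, map_pow, MonoidAlgebra.basis_apply]
  rfl

variable {P} in
/-- The homomorphism `g ↦ g`, `x ↦ u x`, `y ↦ y` between two algebras `H` whose parameters differ
only in the scalar `β`. -/
theorem exists_rescaleHom {P' : HParams K G} (d : P.Deriv) (d' : P'.Deriv) (hχ : P'.χ = P.χ)
    (hη : P'.η = P.η) (hb : P'.b = P.b) (u : Kˣ) (h : P.e = (u : K) • P'.e) :
    ∃ φ : P.H d →ₐ[K] P'.H d', (∀ g, φ (P.gen d g) = P'.gen d' g) ∧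
      φ (P.x d) = (u : K) • P'.x d' ∧ φ (P.y d) = P'.y d' := by
  refine ⟨P.liftH (P'.gen d') ((u : K) • P'.x d') (P'.y d') (fun g => ?_) (fun g => ?_) ?_,
    P.liftH_gen _ _ _ _ _ _ _, P.liftH_x _ _ _ _ _ _ _, P.liftH_y _ _ _ _ _ _ _⟩
  · rw [smul_mul_assoc, x_mul_gen, mul_smul_comm, hχ, smul_comm]
  · rw [y_mul_gen, hη]
  · have h1 : P'.ι d' P.e = P.β • (1 - P'.gen d' P.c * P'.gen d' P.b) := by
      simp only [e, map_smul, map_sub, map_one, map_mul]; rfl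
    rw [← h1, h, mul_smul_comm, y_mul_x, smul_mul_assoc, hη, hb, smul_add, map_smul, smul_comm]

variable {P} in
/-- Rescaling `x` by `u` is an isomorphism from `H(G, χ, η, b, c, β)` to
`H(G, χ, η, b, c, β')` as soon as `β (1 - c b) = u β' (1 - c b)`. -/
theorem nonempty_bialgEquiv {P' : HParams K G} (d : P.Deriv) (d' : P'.Deriv) (hχ : P'.χ = P.χ)
    (hη : P'.η = P.η) (hb : P'.b = P.b) (hc : P'.c = P.c) (u : Kˣ) (h : P.e = (u : K) • P'.e) :
    Nonempty (P.H d ≃ₐc[K] P'.H d') := by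
  have h' : P'.e = ((u⁻¹ : Kˣ) : K) • P.e := by
    rw [h, smul_smul, ← Units.val_mul, inv_mul_cancel, Units.val_one, one_smul]
  obtain ⟨φ, hg, hx, hy⟩ := exists_rescaleHom d d' hχ hη hb u h
  obtain ⟨ψ, hg', hx', hy'⟩ := exists_rescaleHom d' d hχ.symm hη.symm hb.symm u⁻¹ h'
  have hu : (u : K) * ((u⁻¹ : Kˣ) : K) = 1 := by
    rw [← Units.val_mul, mul_inv_cancel, Units.val_one]
  have h1 : φ.comp ψ = AlgHom.id K _ := by
    refine algHom_ext (fun g => ?_) ?_ ?_ <;> rw [AlgHom.comp_apply, AlgHom.id_apply]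
    · rw [hg', hg]
    · rw [hx', map_smul, hx, smul_smul, mul_comm, hu, one_smul]
    · rw [hy', hy]
  have h2 : ψ.comp φ = AlgHom.id K _ := by
    refine algHom_ext (fun g => ?_) ?_ ?_ <;> rw [AlgHom.comp_apply, AlgHom.id_apply]
    · rw [hg, hg']
    · rw [hx, map_smul, hx', smul_smul, hu, one_smul]
    · rw [hy, hy']
  refine ⟨BialgEquiv.ofAlgEquiv (AlgEquiv.ofAlgHom φ ψ h1 h2) ?_ ?_⟩
  · change (P'.counitHom d').comp φ = P.counitHom d
    refine algHom_ext (fun g => ?_) ?_ ?_ <;> rw [AlgHom.comp_apply]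
    · rw [hg, counitHom_gen, counitHom_gen]
    · rw [hx, map_smul, counitHom_x, counitHom_x, smul_zero]
    · rw [hy, counitHom_y, counitHom_y]
  · change (Algebra.TensorProduct.map φ φ).comp (P.comulHom d) = (P'.comulHom d').comp φ
    refine algHom_ext (fun g => ?_) ?_ ?_ <;> rw [AlgHom.comp_apply, AlgHom.comp_apply]
    · rw [hg, comulHom_gen, comulHom_gen, Algebra.TensorProduct.map_tmul, hg]
    · rw [hx, map_smul, comulHom_x, comulHom_x, map_add, Algebra.TensorProduct.map_tmul,
        Algebra.TensorProduct.map_tmul, hg, hx, hb, map_one, TensorProduct.tmul_smul,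
        ← TensorProduct.smul_tmul', smul_add]
    · rw [hy, comulHom_y, comulHom_y, map_add, Algebra.TensorProduct.map_tmul,
        Algebra.TensorProduct.map_tmul, hg, hy, hc, map_one]

end HParams

/-! ### Domains, the antipode and Noetherianity of `H` -/

namespace HParams

variable {K G : Type*} [Field K] [Group G] (P : HParams K G) (d : P.Deriv)

theorem ι_injective : Function.Injective (P.ι d) :=
  (OreExtension.C_injective _).comp (OreExtension.C_injective _)

theorem gen_ne_zero (g : G) : P.gen d g ≠ 0 := by
  simpa [basis_apply] using (P.basis d).ne_zero (g, 0, 0)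

theorem x_ne_zero : P.x d ≠ 0 := by
  simpa [basis_apply] using (P.basis d).ne_zero (1, 1, 0)

theorem y_ne_zero : P.y d ≠ 0 := by
  simpa [basis_apply] using (P.basis d).ne_zero (1, 0, 1)

theorem isDomain_iff : IsDomain (P.H d) ↔ IsDomain (MonoidAlgebra K G) := by
  refine ⟨fun _ => (P.ι_injective d).isDomain (P.ι d), fun _ => ?_⟩
  have := OreExtension.isDomain P.oreX
  exact OreExtension.isDomain (P.oreY d)

theorem antipode_antipode_gen (g : G) :
    P.antipodeMap d (P.antipodeMap d (P.gen d g)) = P.gen d g := by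
  rw [antipodeMap_gen, antipodeMap_gen, inv_inv]

theorem antipode_antipode_x :
    P.antipodeMap d (P.antipodeMap d (P.x d)) = (P.χ P.b : K) • P.x d := by
  rw [antipodeMap_x, map_neg, antipodeMap_mul, antipodeMap_x, antipodeMap_gen, inv_inv, neg_mul,
    neg_neg, mul_assoc, x_mul_gen, mul_smul_comm, ← mul_assoc, gen_inv_mul, one_mul]

theorem antipode_antipode_y :
    P.antipodeMap d (P.antipodeMap d (P.y d)) = (P.η P.c : K) • P.y d := by
  rw [antipodeMap_y, map_neg, antipodeMap_mul, antipodeMap_y, antipodeMap_gen, inv_inv, neg_mul,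
    neg_neg, mul_assoc, y_mul_gen, mul_smul_comm, ← mul_assoc, gen_inv_mul, one_mul]

/-- The square of the antipode, as an algebra endomorphism. -/
noncomputable def antipodeSq : P.H d →ₐ[K] P.H d :=
  AlgHom.ofLinearMap (P.antipodeMap d ∘ₗ P.antipodeMap d)
    (by rw [LinearMap.comp_apply, antipodeMap_one, antipodeMap_one])
    (fun a a' => by simp only [LinearMap.comp_apply, antipodeMap_mul])

theorem antipodeMap_pow_two_mul (n : ℕ) (a : P.H d) :
    (P.antipodeMap d ^ (2 * n) : Module.End K (P.H d)) a = (P.antipodeSq d ^ n) a := by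
  induction n with
  | zero => rfl
  | succ n ih =>
    rw [mul_add, mul_one, add_comm, pow_add, Module.End.mul_apply, ih, pow_succ' (P.antipodeSq d)]
    rfl

theorem antipodeSq_pow_gen (n : ℕ) (g : G) : (P.antipodeSq d ^ n) (P.gen d g) = P.gen d g := by
  induction n with
  | zero => rfl
  | succ n ih =>
    rw [pow_succ', AlgHom.mul_apply, ih]
    exact P.antipode_antipode_gen d g

theorem antipodeSq_pow_x (n : ℕ) :
    (P.antipodeSq d ^ n) (P.x d) = ((P.χ P.b ^ n : Kˣ) : K) • P.x d := by
  induction n with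
  | zero => rw [pow_zero, pow_zero, Units.val_one, one_smul]; rfl
  | succ n ih =>
    rw [pow_succ', AlgHom.mul_apply, ih, map_smul, pow_succ, Units.val_mul, mul_smul]
    exact congrArg _ (P.antipode_antipode_x d)

theorem antipodeSq_pow_y (n : ℕ) :
    (P.antipodeSq d ^ n) (P.y d) = ((P.η P.c ^ n : Kˣ) : K) • P.y d := by
  induction n with
  | zero => rw [pow_zero, pow_zero, Units.val_one, one_smul]; rfl
  | succ n ih =>
    rw [pow_succ', AlgHom.mul_apply, ih, map_smul, pow_succ, Units.val_mul, mul_smul]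
    exact congrArg _ (P.antipode_antipode_y d)

theorem antipodeMap_pow_two_mul_eq_one_iff (n : ℕ) :
    (P.antipodeMap d ^ (2 * n) : Module.End K (P.H d)) = 1 ↔ P.χ P.b ^ n = 1 ∧ P.η P.c ^ n = 1 := by
  have key {a : P.H d} (ha : a ≠ 0) {u : Kˣ} (h : (u : K) • a = a) : u = 1 := by
    refine Units.ext (smul_left_injective K ha ?_)
    simpa using h
  refine ⟨fun h => ⟨key (P.x_ne_zero d) ?_, key (P.y_ne_zero d) ?_⟩, fun ⟨hx, hy⟩ => ?_⟩
  · rw [← antipodeSq_pow_x, ← antipodeMap_pow_two_mul, h]; rfl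
  · rw [← antipodeSq_pow_y, ← antipodeMap_pow_two_mul, h]; rfl
  · have h1 : P.antipodeSq d ^ n = AlgHom.id K _ := by
      refine algHom_ext (fun g => ?_) ?_ ?_ <;> rw [AlgHom.id_apply]
      · exact P.antipodeSq_pow_gen d n g
      · rw [antipodeSq_pow_x, hx, Units.val_one, one_smul]
      · rw [antipodeSq_pow_y, hy, Units.val_one, one_smul]
    ext a
    rw [antipodeMap_pow_two_mul, h1]; rfl

theorem isOfFinOrder_antipodeMap_iff :
    IsOfFinOrder (P.antipodeMap d : Module.End K (P.H d)) ↔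
      IsOfFinOrder (P.χ P.b) ∧ IsOfFinOrder (P.η P.c) := by
  simp only [isOfFinOrder_iff_pow_eq_one]
  constructor
  · rintro ⟨n, hn, h⟩
    obtain ⟨hx, hy⟩ := (P.antipodeMap_pow_two_mul_eq_one_iff d n).1
      (by rw [mul_comm, pow_mul, h, one_pow])
    exact ⟨⟨n, hn, hx⟩, ⟨n, hn, hy⟩⟩
  · rintro ⟨⟨m, hm, hx⟩, ⟨n, hn, hy⟩⟩
    refine ⟨2 * (m * n), by positivity, (P.antipodeMap_pow_two_mul_eq_one_iff d _).2 ⟨?_, ?_⟩⟩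
    · rw [pow_mul, hx, one_pow]
    · rw [mul_comm m n, pow_mul, hy, one_pow]

theorem antipodeMap_surjective : Function.Surjective (P.antipodeMap d) := by
  intro a
  have ha : a ∈ Algebra.adjoin K ({P.y d, P.x d} ∪ Set.range (P.gen d)) := by
    rw [adjoin_gen_eq_top]; exact Algebra.mem_top
  induction ha using Algebra.adjoin_induction with
  | mem r hr =>
    obtain (rfl | rfl) | ⟨g, rfl⟩ := hr
    · exact ⟨-(P.y d * P.gen d (P.c : G)⁻¹), by simp [antipodeMap_mul, ← mul_assoc, gen_mul_inv]⟩
    · exact ⟨-(P.x d * P.gen d (P.b : G)⁻¹), by simp [antipodeMap_mul, ← mul_assoc, gen_mul_inv]⟩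
    · exact ⟨P.gen d g⁻¹, by simp⟩
  | algebraMap k =>
    exact ⟨k • 1, by rw [map_smul, antipodeMap_one, Algebra.algebraMap_eq_smul_one]⟩
  | add x y _ _ hx hy =>
    obtain ⟨s, rfl⟩ := hx
    obtain ⟨t, rfl⟩ := hy
    exact ⟨s + t, map_add _ _ _⟩
  | mul x y _ _ hx hy =>
    obtain ⟨s, rfl⟩ := hx
    obtain ⟨t, rfl⟩ := hy
    exact ⟨t * s, P.antipodeMap_mul d _ _⟩

theorem isNoetherianRing_H (hG : IsPolycyclicByFinite G) : IsNoetherianRing (P.H d) := by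
  have := hG.isNoetherianRing (K := K)
  have := OreExtension.isNoetherianRing P.oreX
  exact OreExtension.isNoetherianRing (P.oreY d)

/-- The antipode is a surjection of `H` onto its opposite, so `H` is right Noetherian because it is
left Noetherian. -/
theorem isNoetherianRing_mulOpposite_H (hG : IsPolycyclicByFinite G) :
    IsNoetherianRing (P.H d)ᵐᵒᵖ := by
  have := P.isNoetherianRing_H d hG
  refine isNoetherianRing_of_surjective (P.H d) _ (P.antipodeHom d).toRingHom fun a => ?_
  obtain ⟨s, hs⟩ := P.antipodeMap_surjective d a.unop
  exact ⟨s, MulOpposite.unop_injective hs⟩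

end HParams

/-! ### Subcoalgebras and group-like elements -/

section Subcoalgebra

variable {K C : Type*} [Field K] [AddCommGroup C] [Module K C] [Coalgebra K C]

/-- A subcoalgebra is stable under contracting the right tensor factor of `Δ` with a functional. -/
theorem IsSubcoalgebra.rid_lTensor_comul_mem {D : Submodule K C} (hD : IsSubcoalgebra K D)
    (f : C →ₗ[K] K) {a : C} (ha : a ∈ D) :
    TensorProduct.rid K C (f.lTensor C (Coalgebra.comul (R := K) a)) ∈ D := by
  obtain ⟨t, ht⟩ := hD a ha
  rw [← ht]
  clear ht
  induction t using TensorProduct.induction_on with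
  | zero => simp
  | add s t hs ht => rw [map_add, map_add, map_add]; exact add_mem hs ht
  | tmul p q =>
    simp only [TensorProduct.mapIncl, TensorProduct.map_tmul, LinearMap.lTensor_tmul,
      TensorProduct.rid_tmul]
    exact D.smul_mem _ p.2

theorem IsGroupLikeElem.isSubcoalgebra_span {a : C} (ha : IsGroupLikeElem K a) :
    IsSubcoalgebra K (K ∙ a) := by
  intro b hb
  obtain ⟨k, rfl⟩ := Submodule.mem_span_singleton.1 hb
  rw [map_smul, ha.comul_eq_tmul_self]
  exact Submodule.smul_mem _ _ ⟨⟨a, Submodule.mem_span_singleton_self a⟩ ⊗ₜ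
    ⟨a, Submodule.mem_span_singleton_self a⟩, rfl⟩

end Subcoalgebra

namespace HParams

variable {K G : Type*} [Field K] [Group G] (P : HParams K G) (d : P.Deriv)

/-- The span of the tensors `u ⊗ g x ^ i y ^ j` with `i + j < n`. -/
noncomputable def rightDegreeLT (n : ℕ) : Submodule K (P.H d ⊗[K] P.H d) :=
  Submodule.span K {t | ∃ u g i j, i + j < n ∧ t = u ⊗ₜ (P.gen d g * P.x d ^ i * P.y d ^ j)}

/-- The span of the tensors `u ⊗ g x ^ i` with `i < n`. -/
noncomputable def rightXDegreeLT (n : ℕ) : Submodule K (P.H d ⊗[K] P.H d) :=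
  Submodule.span K {t | ∃ u g i, i < n ∧ t = u ⊗ₜ (P.gen d g * P.x d ^ i)}

theorem mul_comul_x_mem {n : ℕ} {t : P.H d ⊗[K] P.H d} (ht : t ∈ P.rightXDegreeLT d n) :
    t * P.comulHom d (P.x d) ∈ P.rightXDegreeLT d (n + 1) := by
  induction ht using Submodule.span_induction with
  | mem t ht =>
    obtain ⟨u, g, i, hi, rfl⟩ := ht
    rw [comulHom_x, mul_add, Algebra.TensorProduct.tmul_mul_tmul,
      Algebra.TensorProduct.tmul_mul_tmul, mul_one, mul_assoc, ← pow_succ]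
    exact add_mem (Submodule.subset_span ⟨_, g, i, by omega, rfl⟩)
      (Submodule.subset_span ⟨_, g, i + 1, by omega, rfl⟩)
  | zero => rw [zero_mul]; exact zero_mem _
  | add s t _ _ hs ht => rw [add_mul]; exact add_mem hs ht
  | smul k t _ ht => rw [smul_mul_assoc]; exact Submodule.smul_mem _ _ ht

theorem mul_comul_y_mem {n : ℕ} {t : P.H d ⊗[K] P.H d} (ht : t ∈ P.rightDegreeLT d n) :
    t * P.comulHom d (P.y d) ∈ P.rightDegreeLT d (n + 1) := by
  induction ht using Submodule.span_induction with
  | mem t ht =>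
    obtain ⟨u, g, i, j, hi, rfl⟩ := ht
    rw [comulHom_y, mul_add, Algebra.TensorProduct.tmul_mul_tmul,
      Algebra.TensorProduct.tmul_mul_tmul, mul_one, mul_assoc _ _ (P.y d), ← pow_succ]
    exact add_mem (Submodule.subset_span ⟨_, g, i, j, by omega, rfl⟩)
      (Submodule.subset_span ⟨_, g, i, j + 1, by omega, rfl⟩)
  | zero => rw [zero_mul]; exact zero_mem _
  | add s t _ _ hs ht => rw [add_mul]; exact add_mem hs ht
  | smul k t _ ht => rw [smul_mul_assoc]; exact Submodule.smul_mem _ _ ht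

theorem comul_gen_mul_x_pow (g : G) (i : ℕ) :
    P.comulHom d (P.gen d g * P.x d ^ i) -
      (P.gen d g * P.gen d P.b ^ i) ⊗ₜ (P.gen d g * P.x d ^ i) ∈ P.rightXDegreeLT d i := by
  induction i with
  | zero =>
    rw [pow_zero, pow_zero, mul_one, comulHom_gen, sub_self]
    exact zero_mem _
  | succ i ih =>
    have h := P.mul_comul_x_mem d ih
    rw [sub_mul, ← map_mul, mul_assoc, ← pow_succ, comulHom_x, mul_add,
      Algebra.TensorProduct.tmul_mul_tmul, Algebra.TensorProduct.tmul_mul_tmul, mul_one,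
      mul_assoc (P.gen d g) (P.x d ^ i), ← pow_succ, mul_assoc _ _ (P.gen d P.b),
      ← pow_succ, ← sub_sub, sub_right_comm] at h
    rw [← sub_add_cancel (P.comulHom d _ - _) ((P.gen d g * P.gen d P.b ^ i * P.x d) ⊗ₜ[K]
      (P.gen d g * P.x d ^ i))]
    exact add_mem h (Submodule.subset_span ⟨_, g, i, by omega, rfl⟩)

/-- The leading term of `Δ (g x ^ i y ^ j)` with respect to the degree of the right tensor factor
in `x` and `y`. -/
theorem comul_monomial (g : G) (i j : ℕ) :
    P.comulHom d (P.gen d g * P.x d ^ i * P.y d ^ j) -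
      (P.gen d g * P.gen d P.b ^ i * P.gen d P.c ^ j) ⊗ₜ
        (P.gen d g * P.x d ^ i * P.y d ^ j) ∈ P.rightDegreeLT d (i + j) := by
  induction j with
  | zero =>
    rw [pow_zero, pow_zero, mul_one, mul_one]
    refine Submodule.span_mono ?_ (P.comul_gen_mul_x_pow d g i)
    rintro _ ⟨u, g, k, hk, rfl⟩
    exact ⟨u, g, k, 0, hk, by rw [pow_zero, mul_one]⟩
  | succ j ih =>
    have h := P.mul_comul_y_mem d ih
    rw [sub_mul, ← map_mul, mul_assoc _ _ (P.y d), ← pow_succ, comulHom_y, mul_add,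
      Algebra.TensorProduct.tmul_mul_tmul, Algebra.TensorProduct.tmul_mul_tmul, mul_one,
      mul_assoc (P.gen d g * P.x d ^ i) (P.y d ^ j), ← pow_succ,
      mul_assoc _ _ (P.gen d P.c), ← pow_succ, ← sub_sub, sub_right_comm] at h
    rw [← sub_add_cancel (P.comulHom d _ - _) ((P.gen d g * P.gen d P.b ^ i *
      P.gen d P.c ^ j * P.y d) ⊗ₜ[K] (P.gen d g * P.x d ^ i * P.y d ^ j))]
    exact add_mem h (Submodule.subset_span ⟨_, g, i, j, by omega, rfl⟩)

theorem lTensor_coord_eq_zero {n : ℕ} {t : P.H d ⊗[K] P.H d} (ht : t ∈ P.rightDegreeLT d n)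
    (g : G) (i j : ℕ) (h : n ≤ i + j) : ((P.basis d).coord (g, i, j)).lTensor (P.H d) t = 0 := by
  induction ht using Submodule.span_induction with
  | mem t ht =>
    obtain ⟨u, g', i', j', hi, rfl⟩ := ht
    rw [← basis_apply, LinearMap.lTensor_tmul, Module.Basis.coord_apply, Module.Basis.repr_self,
      Finsupp.single_eq_of_ne, TensorProduct.tmul_zero]
    rintro ⟨⟩
    omega
  | zero => exact map_zero _
  | add s t _ _ hs ht => rw [map_add, hs, ht, add_zero]
  | smul k t _ ht => rw [map_smul, ht, smul_zero]

/-- Contracting the right factor of `Δ a` with the coordinate of a basis element of maximal degree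
in `a` leaves a multiple of a group element. -/
theorem rid_lTensor_coord_comul (a : P.H d) (g : G) (i j : ℕ)
    (h : ∀ g' i' j', (P.basis d).repr a (g', i', j') ≠ 0 → i' + j' ≤ i + j) :
    TensorProduct.rid K _ (((P.basis d).coord (g, i, j)).lTensor (P.H d) (P.comulHom d a)) =
      (P.basis d).repr a (g, i, j) • P.gen d (g * P.b ^ i * P.c ^ j) := by
  classical
  -- Only the leading term of `Δ` on a basis element can have a nonzero `(g, i, j)` coordinate.
  have key (p : G × ℕ × ℕ) (hp : (P.basis d).repr a p ≠ 0) :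
      TensorProduct.rid K _ (((P.basis d).coord (g, i, j)).lTensor (P.H d)
        (P.comulHom d (P.basis d p))) =
      if p = (g, i, j) then P.gen d (g * P.b ^ i * P.c ^ j) else 0 := by
    obtain ⟨g', i', j'⟩ := p
    have h1 := P.lTensor_coord_eq_zero d (P.comul_monomial d g' i' j') g i j (h g' i' j' hp)
    rw [map_sub, sub_eq_zero] at h1
    rw [basis_apply, h1, ← basis_apply, LinearMap.lTensor_tmul, Module.Basis.coord_apply,
      Module.Basis.repr_self, TensorProduct.rid_tmul, Finsupp.single_apply]
    split_ifs with heq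
    · obtain ⟨rfl, rfl, rfl⟩ : g' = g ∧ i' = i ∧ j' = j := by simpa using heq
      rw [one_smul, map_mul, map_mul, map_pow, map_pow]
    · rw [zero_smul]
  conv_lhs => rw [← (P.basis d).linearCombination_repr a, Finsupp.linearCombination_apply,
    Finsupp.sum]
  simp only [map_sum, map_smul]
  rw [Finset.sum_congr rfl fun p hp => by rw [key p (Finsupp.mem_support_iff.1 hp)]]
  simp only [smul_ite, smul_zero, Finset.sum_ite_eq', Finsupp.mem_support_iff]
  split_ifs with h0
  · rfl
  · rw [not_not.1 h0, zero_smul]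

theorem isGroupLikeElem_gen (g : G) : IsGroupLikeElem K (P.gen d g) :=
  ⟨P.counitHom_gen d g, P.comulHom_gen d g⟩

/-- Every nonzero subcoalgebra of `H` contains an element of `G`. -/
theorem exists_gen_mem {D : Submodule K (P.H d)} (hD : IsSubcoalgebra K D) (h0 : D ≠ ⊥) :
    ∃ g, P.gen d g ∈ D := by
  obtain ⟨a, ha, ha0⟩ := Submodule.exists_mem_ne_zero_of_ne_bot h0
  have hne : ((P.basis d).repr a).support.Nonempty := by
    rwa [Finsupp.support_nonempty_iff, ne_eq, LinearEquiv.map_eq_zero_iff]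
  obtain ⟨⟨g, i, j⟩, hp, hmax⟩ := Finset.exists_max_image _
    (fun p : G × ℕ × ℕ => p.2.1 + p.2.2) hne
  have h := hD.rid_lTensor_comul_mem ((P.basis d).coord (g, i, j)) ha
  rw [comul_def, P.rid_lTensor_coord_comul d a g i j fun g' i' j' h' =>
    hmax (g', i', j') (Finsupp.mem_support_iff.2 h')] at h
  exact ⟨_, (D.smul_mem_iff (Finsupp.mem_support_iff.1 hp)).1 h⟩

theorem isPointedCoalgebra : IsPointedCoalgebra K (P.H d) := by
  rintro D ⟨hD, h0, hmin⟩
  obtain ⟨g, hg⟩ := P.exists_gen_mem d hD h0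
  obtain h | h := hmin (K ∙ P.gen d g) ((Submodule.span_singleton_le_iff_mem _ _).2 hg)
    (P.isGroupLikeElem_gen d g).isSubcoalgebra_span
  · exact absurd (Submodule.span_singleton_eq_bot.1 h) (P.gen_ne_zero d g)
  · rw [← h]
    exact finrank_span_singleton (P.gen_ne_zero d g)

theorem setOf_isGroupLikeElem : {a : P.H d | IsGroupLikeElem K a} = Set.range (P.gen d) := by
  ext a
  refine ⟨fun ha => ?_, ?_⟩
  · have ha' : IsGroupLikeElem K a := ha
    obtain ⟨g, hg⟩ := P.exists_gen_mem d ha'.isSubcoalgebra_span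
      (mt Submodule.span_singleton_eq_bot.1 ha'.ne_zero)
    obtain ⟨k, hk⟩ := Submodule.mem_span_singleton.1 hg
    have h1 := congrArg (Coalgebra.counit (R := K)) hk
    rw [map_smul, ha'.counit_eq_one, (P.isGroupLikeElem_gen d g).counit_eq_one, smul_eq_mul,
      mul_one] at h1
    exact ⟨g, by rw [← hk, h1, one_smul]⟩
  · rintro ⟨g, rfl⟩
    exact P.isGroupLikeElem_gen d g

end HParams

/-! ### Growth and Gelfand–Kirillov dimension -/

section GKdim

variable {K : Type*} [Field K] {R : Type*} [Ring R] [Algebra K R]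

/-- For `n ≥ 2`, where `log n > 0`, the quotient of logarithms in `GKdim` can be cleared of its
denominator. -/
theorem eventually_log_finrank_le_of_GKdim_le {r s : ℝ} (h : GKdim K R ≤ (r : EReal)) (hrs : r < s)
    {V : Submodule K R} (hV : V.FG) :
    ∀ᶠ n : ℕ in Filter.atTop,
      Real.log (Module.finrank K ((1 ⊔ V) ^ n : Submodule K R)) ≤ s * Real.log n := by
  have h1 := Filter.eventually_lt_of_limsup_lt
    (((le_iSup₂_of_le V hV le_rfl).trans h).trans_lt (EReal.coe_lt_coe_iff.2 hrs))
  filter_upwards [h1, Filter.eventually_ge_atTop 2] with n hn hn2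
  have h0 : 0 < Real.log n := Real.log_pos (by exact_mod_cast hn2)
  exact ((div_lt_iff₀ h0).1 (EReal.coe_lt_coe_iff.1 hn)).le

theorem frequently_le_log_finrank_of_le_GKdim {r s : ℝ} (h : (r : EReal) ≤ GKdim K R)
    (hrs : s < r) :
    ∃ V : Submodule K R, V.FG ∧ ∃ᶠ n : ℕ in Filter.atTop,
      s * Real.log n ≤ Real.log (Module.finrank K ((1 ⊔ V) ^ n : Submodule K R)) := by
  obtain ⟨V, h1⟩ := lt_iSup_iff.1 ((EReal.coe_lt_coe_iff.2 hrs).trans_le h)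
  obtain ⟨hV, h2⟩ := lt_iSup_iff.1 h1
  refine ⟨V, hV, ((Filter.frequently_lt_of_lt_limsup (h := h2)).and_eventually
    (Filter.eventually_ge_atTop 2)).mono ?_⟩
  rintro n ⟨hn, hn2⟩
  have h0 : 0 < Real.log n := Real.log_pos (by exact_mod_cast hn2)
  exact ((lt_div_iff₀ h0).1 (EReal.coe_lt_coe_iff.1 hn)).le

theorem GKdim_le_of_eventually {r : ℝ}
    (h : ∀ V : Submodule K R, V.FG → ∀ s, r < s → ∀ᶠ n : ℕ in Filter.atTop,
      Real.log (Module.finrank K ((1 ⊔ V) ^ n : Submodule K R)) ≤ s * Real.log n) :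
    GKdim K R ≤ (r : EReal) := by
  refine iSup₂_le fun V hV => EReal.le_of_forall_lt_iff_le.1 fun s hs => ?_
  refine Filter.limsup_le_of_le (h := ?_)
  filter_upwards [h V hV s (EReal.coe_lt_coe_iff.1 hs), Filter.eventually_ge_atTop 2] with n hn hn2
  have h0 : 0 < Real.log n := Real.log_pos (by exact_mod_cast hn2)
  exact EReal.coe_le_coe_iff.2 ((div_le_iff₀ h0).2 hn)

theorem le_GKdim_of_frequently {r : ℝ}
    (h : ∀ s < r, ∃ V : Submodule K R, V.FG ∧ ∃ᶠ n : ℕ in Filter.atTop,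
      s * Real.log n ≤ Real.log (Module.finrank K ((1 ⊔ V) ^ n : Submodule K R))) :
    (r : EReal) ≤ GKdim K R := by
  refine EReal.ge_of_forall_gt_iff_ge.1 fun s hs => ?_
  obtain ⟨V, hV, hf⟩ := h s (EReal.coe_lt_coe_iff.1 hs)
  refine le_iSup₂_of_le V hV (Filter.le_limsup_of_frequently_le
    ((hf.and_eventually (Filter.eventually_ge_atTop 2)).mono ?_))
  rintro n ⟨hn, hn2⟩
  have h0 : 0 < Real.log n := Real.log_pos (by exact_mod_cast hn2)
  exact EReal.coe_le_coe_iff.2 ((le_div_iff₀ h0).2 hn)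

theorem Module.Basis.exists_finset_le_span {ι M : Type*} [AddCommGroup M] [Module K M]
    (B : Module.Basis ι K M) {V : Submodule K M} (hV : V.FG) :
    ∃ T : Finset ι, V ≤ Submodule.span K (B '' T) := by
  classical
  induction V, hV using Submodule.fg_induction with
  | singleton a =>
    exact ⟨(B.repr a).support,
      (Submodule.span_singleton_le_iff_mem _ _).2 (B.mem_span_repr_support a)⟩
  | sup V W _ _ hV hW =>
    obtain ⟨S, hS⟩ := hV
    obtain ⟨T, hT⟩ := hW
    refine ⟨S ∪ T, sup_le (hS.trans (Submodule.span_mono ?_)) (hT.trans (Submodule.span_mono ?_))⟩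
    · exact Set.image_mono (by simp)
    · exact Set.image_mono (by simp)

theorem Module.Basis.finrank_span_image {ι M : Type*} [AddCommGroup M] [Module K M]
    (B : Module.Basis ι K M) (T : Finset ι) :
    Module.finrank K (Submodule.span K (B '' T)) = T.card := by
  classical
  rw [← Finset.coe_image, finrank_span_finset_eq_card, Finset.card_image_of_injective _ B.injective]
  rw [Finset.coe_image]
  exact (B.linearIndependent.linearIndepOn_id).mono (Set.image_subset_range _ _)

end GKdim

section GroupAlgebraGrowth

open scoped Pointwise

variable {K G : Type*} [Field K] [Group G]

theorem finrank_span_of (S : Finset G) :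
    Module.finrank K (Submodule.span K (MonoidAlgebra.of K G '' S)) = S.card := by
  have h : ⇑(MonoidAlgebra.of K G) = MonoidAlgebra.basis G K := by
    ext1 g; rw [MonoidAlgebra.basis_apply]; rfl
  rw [h, Module.Basis.finrank_span_image]

theorem one_le_span_of {S : Finset G} (hS : 1 ∈ S) :
    1 ≤ Submodule.span K (MonoidAlgebra.of K G '' S) :=
  Submodule.one_le.2 (Submodule.subset_span ⟨1, hS, map_one _⟩)

variable [DecidableEq G]

theorem span_of_pow (S : Finset G) (n : ℕ) :
    Submodule.span K (MonoidAlgebra.of K G '' S) ^ n =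
      Submodule.span K (MonoidAlgebra.of K G '' (S ^ n : Finset G)) := by
  rw [Submodule.span_pow, Finset.coe_pow, Set.image_pow]

theorem finrank_pow_span_of {S : Finset G} (hS : 1 ∈ S) (n : ℕ) :
    Module.finrank K ((1 ⊔ Submodule.span K (MonoidAlgebra.of K G '' S)) ^ n :
      Submodule K (MonoidAlgebra K G)) = (S ^ n).card := by
  rw [sup_eq_right.2 (one_le_span_of hS), span_of_pow, finrank_span_of]

/-- The growth of any finite-dimensional subspace of `K[G]` is bounded by that of a finite subset
of `G`. -/
theorem exists_finset_finrank_pow_le {V : Submodule K (MonoidAlgebra K G)} (hV : V.FG) :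
    ∃ S : Finset G, 1 ∈ S ∧ ∀ n : ℕ,
      Module.finrank K ((1 ⊔ V) ^ n : Submodule K (MonoidAlgebra K G)) ≤ (S ^ n).card := by
  obtain ⟨T, hT⟩ := (MonoidAlgebra.basis G K).exists_finset_le_span hV
  have hS : (1 : G) ∈ insert 1 T := Finset.mem_insert_self _ _
  refine ⟨insert 1 T, hS, fun n => ?_⟩
  rw [← finrank_pow_span_of (K := K) hS n]
  have hfg : ((1 ⊔ Submodule.span K (MonoidAlgebra.of K G '' (insert 1 T : Finset G))) ^ n :
      Submodule K (MonoidAlgebra K G)).FG := by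
    rw [sup_eq_right.2 (one_le_span_of hS)]
    exact Submodule.FG.pow (Submodule.fg_span ((Finset.finite_toSet _).image _)) n
  have := Module.Finite.iff_fg.2 hfg
  refine Submodule.finrank_mono (pow_le_pow_left' (sup_le_sup_left (hT.trans
    (Submodule.span_mono ?_)) _) n)
  rintro _ ⟨g, hg, rfl⟩
  exact ⟨g, Finset.mem_insert_of_mem hg, by rw [MonoidAlgebra.basis_apply]; rfl⟩

end GroupAlgebraGrowth

namespace OreExtension

theorem finiteType {K R : Type*} [Field K] [Ring R] [Algebra K R] (D : OreData K R)
    [hR : Algebra.FiniteType K R] : Algebra.FiniteType K (OreExtension D) := by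
  classical
  obtain ⟨s, hs⟩ := hR.out
  refine ⟨⟨insert (X D) (s.image (C D)), ?_⟩⟩
  rw [Finset.coe_insert, Finset.coe_image]
  exact adjoin_eq_top D hs

end OreExtension

namespace HParams

open scoped Pointwise

variable {K G : Type*} [Field K] [Group G] (P : HParams K G) (d : P.Deriv)

theorem y_mul_x_pow_succ (i : ℕ) :
    ∃ p q r : K, P.y d * P.x d ^ (i + 1) =
      p • (P.x d ^ (i + 1) * P.y d) + q • P.x d ^ i + r • (P.gen d (P.c * P.b) * P.x d ^ i) := by
  induction i with
  | zero =>
    refine ⟨P.η P.b, P.β, -P.β, ?_⟩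
    rw [zero_add, pow_one, pow_zero, mul_one, y_mul_x, ι_e, map_mul, smul_sub, neg_smul]
    abel
  | succ i ih =>
    obtain ⟨p, q, r, h⟩ := ih
    refine ⟨P.η P.b * p, P.η P.b * q + P.β, P.η P.b * r * P.χ (P.c * P.b) - P.β, ?_⟩
    rw [pow_succ', ← mul_assoc, y_mul_x, ι_e, add_mul, smul_mul_assoc, mul_assoc (P.x d) (P.y d), h,
      mul_add, mul_add, mul_smul_comm, mul_smul_comm, mul_smul_comm, ← mul_assoc (P.x d),
      ← mul_assoc (P.x d), ← pow_succ', ← pow_succ', x_mul_gen, ← map_mul, smul_mul_assoc,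
      smul_mul_assoc, sub_mul, one_mul, mul_assoc _ (P.x d) (P.x d ^ i), ← pow_succ']
    module

/-- The subspace spanned by `x`, `y` and the elements of `S`. -/
noncomputable def generatingSpace (S : Finset G) : Submodule K (P.H d) :=
  Submodule.span K (P.gen d '' S ∪ {P.x d, P.y d})

variable {d}

theorem gen_mem_generatingSpace {S : Finset G} {g : G} (hg : g ∈ S) :
    P.gen d g ∈ P.generatingSpace d S :=
  Submodule.subset_span (Or.inl ⟨g, hg, rfl⟩)

theorem x_mem_generatingSpace (S : Finset G) : P.x d ∈ P.generatingSpace d S :=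
  Submodule.subset_span (Or.inr (Or.inl rfl))

theorem y_mem_generatingSpace (S : Finset G) : P.y d ∈ P.generatingSpace d S :=
  Submodule.subset_span (Or.inr (Or.inr rfl))

theorem one_le_generatingSpace {S : Finset G} (hS : 1 ∈ S) : 1 ≤ P.generatingSpace d S :=
  Submodule.one_le.2 (by simpa using P.gen_mem_generatingSpace (d := d) hS)

theorem fg_generatingSpace (S : Finset G) : (P.generatingSpace d S).FG :=
  Submodule.fg_span (((Finset.finite_toSet S).image _).union (Set.toFinite _))

section Growth

variable [DecidableEq G]

variable (d) in
/-- The span of the elements `w x ^ i y ^ j`, where `w` is a product of `k` elements of `S` and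
`k + i + j ≤ n`. -/
noncomputable def monomialSpan (S : Finset G) (n : ℕ) : Submodule K (P.H d) :=
  Submodule.span K {t | ∃ k i j : ℕ, ∃ w ∈ S ^ k, k + i + j ≤ n ∧
    t = P.gen d w * P.x d ^ i * P.y d ^ j}

theorem monomial_mem_monomialSpan {S : Finset G} {n k : ℕ} {w : G} (hw : w ∈ S ^ k) {i j : ℕ}
    (h : k + i + j ≤ n) : P.gen d w * P.x d ^ i * P.y d ^ j ∈ P.monomialSpan d S n :=
  Submodule.subset_span ⟨k, i, j, w, hw, h, rfl⟩

/-- Moving `y` to the right past a power of `x` trades one `x` and one `y` for the group element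
`c b`, a product of two elements of `S`; hence the total length does not grow. -/
theorem generatingSpace_mul_monomialSpan {S : Finset G} (hb : (P.b : G) ∈ S)
    (hc : (P.c : G) ∈ S) (n : ℕ) :
    P.generatingSpace d S * P.monomialSpan d S n ≤ P.monomialSpan d S (n + 1) := by
  rw [generatingSpace, monomialSpan, Submodule.span_mul_span, Submodule.span_le]
  rintro _ ⟨s, hs, _, ⟨k, i, j, w, hw, hk, rfl⟩, rfl⟩
  simp only [SetLike.mem_coe]
  obtain ⟨g, hg, rfl⟩ | rfl | rfl := hs
  · rw [← mul_assoc, ← mul_assoc, ← map_mul]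
    refine P.monomial_mem_monomialSpan (k := k + 1) ?_ (by omega)
    rw [pow_succ']
    exact Finset.mul_mem_mul hg hw
  · rw [← mul_assoc, ← mul_assoc, x_mul_gen, smul_mul_assoc, smul_mul_assoc,
      mul_assoc _ (P.x d) (P.x d ^ i), ← pow_succ']
    exact Submodule.smul_mem _ _ (P.monomial_mem_monomialSpan hw (by omega))
  · rw [← mul_assoc, ← mul_assoc, y_mul_gen, smul_mul_assoc, smul_mul_assoc]
    refine Submodule.smul_mem _ _ ?_
    obtain _ | i := i
    · have := P.monomial_mem_monomialSpan (d := d) hw (i := 0) (j := j + 1) (n := n + 1) (by omega)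
      rw [pow_zero, mul_one, pow_succ', ← mul_assoc] at this
      rwa [pow_zero, mul_one]
    · obtain ⟨p, q, r, h⟩ := P.y_mul_x_pow_succ d i
      rw [mul_assoc (P.gen d w), h, mul_add, mul_add, mul_smul_comm, mul_smul_comm, mul_smul_comm,
        add_mul, add_mul, smul_mul_assoc, smul_mul_assoc, smul_mul_assoc, ← mul_assoc _ _ (P.y d),
        mul_assoc _ (P.y d), ← pow_succ', ← mul_assoc _ _ (P.x d ^ i), ← map_mul]
      refine add_mem (add_mem ?_ ?_) ?_ <;> refine Submodule.smul_mem _ _ ?_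
      · exact P.monomial_mem_monomialSpan hw (by omega)
      · exact P.monomial_mem_monomialSpan hw (by omega)
      · refine P.monomial_mem_monomialSpan (k := k + 2) ?_ (by omega)
        rw [pow_add, pow_two]
        exact Finset.mul_mem_mul hw (Finset.mul_mem_mul hc hb)

theorem generatingSpace_pow_le {S : Finset G} (hb : (P.b : G) ∈ S)
    (hc : (P.c : G) ∈ S) (n : ℕ) : P.generatingSpace d S ^ n ≤ P.monomialSpan d S n := by
  induction n with
  | zero =>
    rw [pow_zero, Submodule.one_le]
    simpa using P.monomial_mem_monomialSpan (d := d) (S := S) (n := 0) (k := 0) (w := 1)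
      (by simp) (i := 0) (j := 0) le_rfl
  | succ n ih =>
    rw [pow_succ']
    exact (mul_le_mul_right ih _).trans (P.generatingSpace_mul_monomialSpan hb hc n)

/-- The exponents `(w, i, j)` with `w` a product of `n` elements of `S` and `i, j ≤ n`. -/
def exponentBox (S : Finset G) (n : ℕ) : Finset (G × ℕ × ℕ) :=
  (S ^ n) ×ˢ (Finset.range (n + 1) ×ˢ Finset.range (n + 1))

theorem card_exponentBox (S : Finset G) (n : ℕ) :
    (exponentBox S n).card = (S ^ n).card * (n + 1) ^ 2 := by
  rw [exponentBox, Finset.card_product, Finset.card_product, Finset.card_range, pow_two]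

theorem finrank_generatingSpace_pow_le {S : Finset G} (h1 : 1 ∈ S) (hb : (P.b : G) ∈ S)
    (hc : (P.c : G) ∈ S) (n : ℕ) :
    Module.finrank K (P.generatingSpace d S ^ n : Submodule K (P.H d)) ≤
      (S ^ n).card * (n + 1) ^ 2 := by
  rw [← card_exponentBox, ← (P.basis d).finrank_span_image]
  have := Module.Finite.iff_fg.2 (Submodule.fg_span (R := K)
    ((Finset.finite_toSet (exponentBox S n)).image (P.basis d)))
  refine Submodule.finrank_mono ((P.generatingSpace_pow_le hb hc n).trans
    (Submodule.span_mono ?_))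
  rintro _ ⟨k, i, j, w, hw, hk, rfl⟩
  refine ⟨(w, i, j), ?_, P.basis_apply d w i j⟩
  simp only [exponentBox, Finset.coe_product, Set.mem_prod, Finset.mem_coe, Finset.mem_range]
  exact ⟨Finset.pow_subset_pow_right h1 (by omega) hw, by omega, by omega⟩

theorem gen_mem_generatingSpace_pow {S : Finset G} {n : ℕ} {w : G} (hw : w ∈ S ^ n) :
    P.gen d w ∈ P.generatingSpace d S ^ n := by
  induction n generalizing w with
  | zero =>
    rw [pow_zero, Finset.mem_one] at hw
    rw [hw, map_one, pow_zero]
    exact Submodule.one_le.1 le_rfl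
  | succ n ih =>
    rw [pow_succ] at hw ⊢
    obtain ⟨u, hu, g, hg, rfl⟩ := Finset.mem_mul.1 hw
    rw [map_mul]
    exact Submodule.mul_mem_mul (ih hu) (P.gen_mem_generatingSpace hg)

theorem basis_mem_generatingSpace_pow {S : Finset G} (h1 : 1 ∈ S) {k i j n : ℕ} {w : G}
    (hw : w ∈ S ^ k) (h : k + i + j ≤ n) :
    P.basis d (w, i, j) ∈ P.generatingSpace d S ^ n := by
  refine pow_le_pow_right' (P.one_le_generatingSpace h1) h ?_
  rw [basis_apply, pow_add, pow_add]
  exact Submodule.mul_mem_mul (Submodule.mul_mem_mul (P.gen_mem_generatingSpace_pow hw)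
    (Submodule.pow_mem_pow _ (P.x_mem_generatingSpace S) i))
    (Submodule.pow_mem_pow _ (P.y_mem_generatingSpace S) j)

theorem le_finrank_generatingSpace_pow {S : Finset G} (h1 : 1 ∈ S) (n : ℕ) :
    (S ^ n).card * (n + 1) ^ 2 ≤
      Module.finrank K (P.generatingSpace d S ^ (3 * n) : Submodule K (P.H d)) := by
  rw [← card_exponentBox, ← (P.basis d).finrank_span_image]
  have := Module.Finite.iff_fg.2 (Submodule.FG.pow (P.fg_generatingSpace (d := d) S) (3 * n))
  refine Submodule.finrank_mono (Submodule.span_le.2 ?_)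
  rintro _ ⟨⟨w, i, j⟩, hp, rfl⟩
  simp only [exponentBox, Finset.coe_product, Set.mem_prod, Finset.mem_coe, Finset.mem_range] at hp
  exact P.basis_mem_generatingSpace_pow h1 hp.1 (by omega)

theorem exists_le_generatingSpace_pow {V : Submodule K (P.H d)} (hV : V.FG) :
    ∃ (S : Finset G) (m : ℕ), 1 ∈ S ∧ (P.b : G) ∈ S ∧ (P.c : G) ∈ S ∧ 1 ≤ m ∧
      1 ⊔ V ≤ P.generatingSpace d S ^ m := by
  obtain ⟨T, hT⟩ := (P.basis d).exists_finset_le_span hV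
  have h1 : (1 : G) ∈ {1, (P.b : G), (P.c : G)} ∪ T.image Prod.fst := by simp
  refine ⟨{1, (P.b : G), (P.c : G)} ∪ T.image Prod.fst, 1 + T.sup fun p => p.2.1 + p.2.2, h1,
    by simp, by simp, by omega, sup_le ?_ (hT.trans (Submodule.span_le.2 ?_))⟩
  · exact one_le_pow_of_one_le' (P.one_le_generatingSpace h1) _
  · rintro _ ⟨⟨w, i, j⟩, hp, rfl⟩
    refine P.basis_mem_generatingSpace_pow h1 (k := 1) ?_ ?_
    · rw [pow_one]
      exact Finset.mem_union_right _ (Finset.mem_image_of_mem Prod.fst hp)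
    · have := Finset.le_sup (f := fun p : G × ℕ × ℕ => p.2.1 + p.2.2) hp
      simp only at this
      omega

end Growth

/-- The bound `dim (1 + V) ^ n ≤ |S ^ (m n)| (m n + 1) ^ 2`, for `1 + V ≤ Y ^ m`; the factor `m`
only adds a constant to the logarithms. -/
theorem GKdim_H_le {r : ℝ} (h : GKdim K (MonoidAlgebra K G) ≤ (r : EReal)) :
    GKdim K (P.H d) ≤ ((r + 2 : ℝ) : EReal) := by
  classical
  refine GKdim_le_of_eventually fun V hV s hs => ?_
  obtain ⟨S, m, h1, hb, hc, hm, hVS⟩ := P.exists_le_generatingSpace_pow hV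
  obtain ⟨t, hrt, hts⟩ : ∃ t, r < t ∧ t < s - 2 := exists_between (by linarith)
  have hm' : (1 : ℝ) ≤ m := by exact_mod_cast hm
  have hmn : Filter.Tendsto (fun n : ℕ => m * n) Filter.atTop Filter.atTop :=
    Filter.tendsto_id.const_mul_atTop' (by omega)
  have hlog : Filter.Tendsto (fun n : ℕ => (s - 2 - t) * Real.log n) Filter.atTop Filter.atTop :=
    (Real.tendsto_log_atTop.comp tendsto_natCast_atTop_atTop).const_mul_atTop (by linarith)
  filter_upwards [hmn.eventually (eventually_log_finrank_le_of_GKdim_le h hrt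
      (Submodule.fg_span (((Finset.finite_toSet S).image (MonoidAlgebra.of K G))))),
    hlog.eventually_ge_atTop (t * Real.log m + 2 * Real.log (2 * m)),
    Filter.eventually_ge_atTop 1] with n hn hlarge hn1
  have hn1' : (1 : ℝ) ≤ n := by exact_mod_cast hn1
  rw [finrank_pow_span_of h1, Nat.cast_mul, Real.log_mul (by positivity) (by positivity)] at hn
  have hcard : 0 < (S ^ (m * n)).card := Finset.card_pos.2 ⟨1, Finset.one_mem_pow h1⟩
  have hle : Module.finrank K ((1 ⊔ V) ^ n : Submodule K (P.H d)) ≤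
      (S ^ (m * n)).card * (m * n + 1) ^ 2 := by
    refine le_trans ?_ (P.finrank_generatingSpace_pow_le (d := d) h1 hb hc (m * n))
    have := Module.Finite.iff_fg.2 (Submodule.FG.pow (P.fg_generatingSpace (d := d) S) (m * n))
    refine Submodule.finrank_mono ?_
    rw [pow_mul]
    exact pow_le_pow_left' hVS n
  have hpos : 0 < Module.finrank K ((1 ⊔ V) ^ n : Submodule K (P.H d)) := by
    have hone : (1 : Submodule K (P.H d)).FG := by
      rw [Submodule.one_eq_span]
      exact Submodule.fg_span_singleton 1
    have := Module.Finite.iff_fg.2 (Submodule.FG.pow (Submodule.FG.sup hone hV) n)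
    refine Module.finrank_pos_iff_exists_ne_zero.2 ⟨⟨1, ?_⟩, fun h0 => ?_⟩
    · exact Submodule.one_le.1 (one_le_pow_of_one_le' le_sup_left n)
    · refine P.gen_ne_zero d 1 ?_
      rw [map_one]
      exact congrArg Subtype.val h0
  have h2 : Real.log (m * n + 1) ≤ Real.log (2 * m) + Real.log n := by
    rw [← Real.log_mul (by positivity) (by positivity)]
    exact Real.log_le_log (by positivity) (by nlinarith)
  calc Real.log (Module.finrank K ((1 ⊔ V) ^ n : Submodule K (P.H d)))
      ≤ Real.log ((S ^ (m * n)).card * (m * n + 1) ^ 2) :=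
        Real.log_le_log (by exact_mod_cast hpos) (by exact_mod_cast hle)
    _ = Real.log (S ^ (m * n)).card + 2 * Real.log (m * n + 1) := by
        rw [Real.log_mul (by positivity) (by positivity), Real.log_pow]; norm_num
    _ ≤ s * Real.log n := by linarith

/-- If `V ≤ K[G]` grows like `n ^ t` along infinitely many `n`, then the span of `S`, `x`, `y`
grows like `n ^ (t + 2)` along the numbers `3 n`, where `S ⊆ G` spans a space containing `V`. -/
theorem le_GKdim_H {r : ℝ} (h : (r : EReal) ≤ GKdim K (MonoidAlgebra K G)) :
    ((r + 2 : ℝ) : EReal) ≤ GKdim K (P.H d) := by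
  classical
  refine le_GKdim_of_frequently fun s hs => ?_
  obtain ⟨t, hst, htr⟩ : ∃ t, s - 2 < t ∧ t < r := exists_between (by linarith)
  obtain ⟨V, hV, hf⟩ := frequently_le_log_finrank_of_le_GKdim h htr
  obtain ⟨S, h1, hS⟩ := exists_finset_finrank_pow_le hV
  refine ⟨P.generatingSpace d S, P.fg_generatingSpace S, ?_⟩
  have h3 : Filter.Tendsto (fun n : ℕ => 3 * n) Filter.atTop Filter.atTop :=
    Filter.tendsto_id.const_mul_atTop' (by omega)
  have hlog : Filter.Tendsto (fun n : ℕ => (t + 2 - s) * Real.log n) Filter.atTop Filter.atTop :=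
    (Real.tendsto_log_atTop.comp tendsto_natCast_atTop_atTop).const_mul_atTop (by linarith)
  refine h3.frequently ((hf.and_eventually ((hlog.eventually_ge_atTop (s * Real.log 3)).and
    (Filter.eventually_ge_atTop 1))).mono ?_)
  rintro n ⟨hn, hlarge, hn1⟩
  have hn1' : (1 : ℝ) ≤ n := by exact_mod_cast hn1
  have hcard : 0 < (S ^ n).card := Finset.card_pos.2 ⟨1, Finset.one_mem_pow h1⟩
  have hle := P.le_finrank_generatingSpace_pow (d := d) h1 n
  rw [sup_eq_right.2 (P.one_le_generatingSpace h1), Nat.cast_mul,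
    Real.log_mul (by norm_num) (by positivity)]
  have hcardV : t * Real.log n ≤ Real.log (S ^ n).card := by
    obtain h0 | h0 := (Module.finrank K ((1 ⊔ V) ^ n :
      Submodule K (MonoidAlgebra K G))).eq_zero_or_pos
    -- In the vacuous case of dimension `0`, the convention `log 0 = 0` does no harm.
    · rw [h0, Nat.cast_zero, Real.log_zero] at hn
      exact hn.trans (Real.log_natCast_nonneg _)
    · exact hn.trans (Real.log_le_log (by exact_mod_cast h0) (by exact_mod_cast hS n))
  have h2 : Real.log n ≤ Real.log (n + 1) := Real.log_le_log (by positivity) (by linarith)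
  calc s * (Real.log (3 : ℕ) + Real.log n)
      ≤ Real.log (S ^ n).card + 2 * Real.log (n + 1) := by
        rw [Nat.cast_ofNat]; linarith
    _ = Real.log ((S ^ n).card * (n + 1) ^ 2) := by
        rw [Real.log_mul (by positivity) (by positivity), Real.log_pow]; norm_num
    _ ≤ _ := Real.log_le_log (by positivity) (by exact_mod_cast hle)

theorem finiteType_H [Group.FG G] : Algebra.FiniteType K (P.H d) := by
  have := (Group.fg_iff_monoid_fg (G := G)).1 inferInstance
  have := OreExtension.finiteType P.oreX
  exact OreExtension.finiteType (P.oreY d)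

end HParams

theorem theorem4p3 {K G : Type*} [Field K] [IsAlgClosed K] [CharZero K] [Group G]
    (P : HParams K G) :
    -- the derivation `δ`, hence `H`, exists exactly if `β (1 - c b) = 0` or `η = χ⁻¹`
    (Nonempty P.Deriv ↔ P.e = 0 ∨ P.η = P.χ⁻¹) ∧
    ∀ d : P.Deriv,
      -- the basis `g x ^ i y ^ j`
      (∃ B : Module.Basis (G × ℕ × ℕ) K (P.H d),
        ∀ g i j, B (g, i, j) = P.gen d g * P.x d ^ i * P.y d ^ j) ∧
      -- the two isomorphism classes; a bialgebra isomorphism automatically preserves the antipode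
      (P.e = 0 ↔ P.β = 0 ∨ P.c = P.b⁻¹) ∧
      (P.e = 0 → ∃ d₀ : HParams.Deriv ⟨P.χ, P.η, P.b, P.c, P.compat, 0⟩,
        Nonempty (P.H d ≃ₐc[K] HParams.H ⟨P.χ, P.η, P.b, P.c, P.compat, 0⟩ d₀)) ∧
      (P.e ≠ 0 → ∃ h : P.η = P.χ⁻¹,
        ∃ d₁ : HParams.Deriv ⟨P.χ, P.χ⁻¹, P.b, P.c, h ▸ P.compat, 1⟩,
          Nonempty (P.H d ≃ₐc[K] HParams.H ⟨P.χ, P.χ⁻¹, P.b, P.c, h ▸ P.compat, 1⟩ d₁)) ∧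
      -- left and right Noetherian
      (IsPolycyclicByFinite G → IsNoetherianRing (P.H d) ∧ IsNoetherianRing (P.H d)ᵐᵒᵖ) ∧
      -- domain
      (IsDomain (P.H d) ↔ IsDomain (MonoidAlgebra K G)) ∧
      -- affine, and Gelfand-Kirillov dimension
      (∀ r : ℝ, Group.FG G → GKdim K (MonoidAlgebra K G) = (r : EReal) →
        Algebra.FiniteType K (P.H d) ∧ GKdim K (P.H d) = ((r + 2 : ℝ) : EReal)) ∧
      -- the square of the antipode
      (∀ g, HopfAlgebra.antipode K (HopfAlgebra.antipode K (P.gen d g)) = P.gen d g) ∧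
      HopfAlgebra.antipode K (HopfAlgebra.antipode K (P.x d)) = (P.χ P.b : K) • P.x d ∧
      HopfAlgebra.antipode K (HopfAlgebra.antipode K (P.y d)) = (P.η P.c : K) • P.y d ∧
      (IsOfFinOrder (HopfAlgebra.antipode K : Module.End K (P.H d)) ↔
        IsOfFinOrder (P.χ P.b) ∧ IsOfFinOrder (P.η P.c)) ∧
      -- pointed, with group-likes `G`
      IsPointedCoalgebra K (P.H d) ∧
      {a : P.H d | IsGroupLikeElem K a} = Set.range (P.gen d) := by
  refine ⟨P.nonempty_deriv_iff, fun d => ⟨⟨P.basis d, P.basis_apply d⟩, P.e_eq_zero_iff, ?_, ?_,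
    fun hG => ⟨P.isNoetherianRing_H d hG, P.isNoetherianRing_mulOpposite_H d hG⟩,
    P.isDomain_iff d, fun r hG hr => ⟨P.finiteType_H (d := d), ?_⟩, P.antipode_antipode_gen d,
    P.antipode_antipode_x d, P.antipode_antipode_y d, P.isOfFinOrder_antipodeMap_iff d,
    P.isPointedCoalgebra d, P.setOf_isGroupLikeElem d⟩⟩
  · intro h
    have h0 : HParams.e ⟨P.χ, P.η, P.b, P.c, P.compat, 0⟩ = 0 := zero_smul _ _
    obtain ⟨d₀⟩ := (HParams.nonempty_deriv_iff _).2 (Or.inl h0)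
    exact ⟨d₀, HParams.nonempty_bialgEquiv d d₀ rfl rfl rfl rfl 1 (by rw [h, h0, smul_zero])⟩
  · intro h
    have hη : P.η = P.χ⁻¹ := (P.nonempty_deriv_iff.1 ⟨d⟩).resolve_left h
    have hβ : P.β ≠ 0 := fun h0 => h (P.e_eq_zero_iff.2 (Or.inl h0))
    obtain ⟨d₁⟩ := (HParams.nonempty_deriv_iff
      ⟨P.χ, P.χ⁻¹, P.b, P.c, hη ▸ P.compat, 1⟩).2 (Or.inr rfl)
    refine ⟨hη, d₁, HParams.nonempty_bialgEquiv d d₁ rfl hη.symm rfl rfl (Units.mk0 P.β hβ) ?_⟩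
    rw [HParams.e, HParams.e, one_smul, Units.val_mk0]
  · exact le_antisymm (P.GKdim_H_le hr.le) (P.le_GKdim_H hr.ge)
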